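/- Let $N\ge 2$ be an integer and $\alpha>0$. Let $$\Omega_N=\{x=(x_1,\dots,x_{N-1})\in\mathbb R^{N-1}:\ 0\le x_1\le\dots\le x_{N-1}\le N\},\qquad x_0:=0,\quad x_N:=N,$$ and let $\rho_\alpha(u)=\frac{\Gamma(2\alpha)}{\Gamma(\alpha)^2}[u(1-u)]^{\alpha-1}$, $u\in(0,1)$, be the symmetric Beta density. For $i\in\{1,\dots,N-1\}$ and $u\in[0,1]$ let $x^{(i,u)}$ be obtained from $x$ by replacing the coordinate $x_i$ with $u\,x_{i-1}+(1-u)\,x_{i+1}$. For $x\in\Omega_N$ let $P_t^x$ be the law at time $t\ge0$ of the continuous-time Markov chain on $\Omega_N$ started at $x$ with generator $$(\mathcal L_{N,\alpha}f)(x)=\sum_{i=1}^{N-1}\int_0^1\bigl(f(x^{(i,u)})-f(x)\bigr)\rho_\alpha(u)\,du ,$$ that is, independently for each $i$, at rate $1$, the coordinate $x_i$ is replaced with $u\,x_{i-1}+(1-u)\,x_{i+1}$, where $u$ is a fresh sample from $\rho_\alpha$. Let $$\pi_{N,\alpha}(dx)=\frac{\Gamma(N\alpha)}{\Gamma(\alpha)^N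 N^{N\alpha-1}}\prod_{i=1}^N (x_i-x_{i-1})^{\alpha-1}\,dx$$ be its equilibrium distribution on $\Omega_N$, where $dx$ is Lebesgue measure. Put $$d_{N,\alpha}(t)=\sup_{x\in\Omega_N}\ \sup_{B\subseteq\Omega_N\text{ Borel}}\bigl(P_t^x(B)-\pi_{N,\alpha}(B)\bigr),\qquad T_{N,\alpha}(\delta)=\inf\{t\ge 0:\ d_{N,\alpha}(t)<\delta\}\quad(\delta\in(0,1)),$$ with $\inf\emptyset=+\infty$. Then for every $\alpha>0$ and every $\varepsilon\in(0,1)$ there is a constant $C_{\alpha,\varepsilon}>0$ such that for all integers $N\ge2$ $$T_{N,\alpha}(1-\varepsilon)\ \ge\ \frac{N^2}{\pi^2}\bigl(\log N-C_{\alpha,\varepsilon}\bigr).$$ -/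

import Mathlib

open MeasureTheory ProbabilityTheory
open scoped NNReal ENNReal

noncomputable section

namespace AdjacentWalk

/-- A configuration `(x_1, …, x_{N-1})`; the entry with index `i : Fin (N - 1)` is `x_{i+1}`. -/
abbrev Config (N : ℕ) : Type := Fin (N - 1) → ℝ

/-- The height `x_k` for every `k`, with the conventions `x_0 = 0` and `x_N = N`. -/
def height {N : ℕ} (x : Config N) (k : ℕ) : ℝ :=
  if k = 0 then 0 else if h : k - 1 < N - 1 then x ⟨k - 1, h⟩ else N

/-- The simplex `Ω_N = {0 ≤ x_1 ≤ ⋯ ≤ x_{N-1} ≤ N}`. -/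
def simplex (N : ℕ) : Set (Config N) :=
  {x | ∀ k < N, height x k ≤ height x (k + 1)}

/-- The transformation `x ↦ x^{(i+1, u)}`: the coordinate `x_{i+1}` is replaced by
`u x_i + (1 - u) x_{i+2}`, the others are unchanged. -/
def resample {N : ℕ} (i : Fin (N - 1)) (u : ℝ) (x : Config N) : Config N :=
  Function.update x i (u * height x i + (1 - u) * height x (i + 2))

/-- The generator
`(L f)(x) = ∑_i ∫ (f (x^{(i,u)}) - f x) ρ_α(u) du` with `ρ_α` the symmetric Beta density. -/
def generator (N : ℕ) (α : ℝ) (f : Config N → ℝ) (x : Config N) : ℝ :=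
  ∑ i : Fin (N - 1), ∫ u, (f (resample i u x) - f x) ∂(betaMeasure α α)

theorem measurable_height {N : ℕ} (k : ℕ) : Measurable fun x : Config N => height x k := by
  unfold height
  split_ifs <;> fun_prop

theorem measurable_resample {N : ℕ} (i : Fin (N - 1)) :
    Measurable fun p : Config N × ℝ => resample i p.2 p.1 := by
  unfold resample
  refine measurable_pi_lambda _ fun j => ?_
  simp only [Function.update_apply]
  have h (k : ℕ) : Measurable fun p : Config N × ℝ => height p.1 k :=
    (measurable_height k).comp measurable_fst
  have h1 := h i
  have h2 := h (i + 2)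
  split_ifs <;> fun_prop

/-- The transition kernel of the embedded jump chain: a uniformly chosen coordinate is
resampled with a `Beta(α, α)` variable. -/
def jumpKernel (N : ℕ) (α : ℝ) : Kernel (Config N) (Config N) where
  toFun x := ((N - 1 : ℕ) : ℝ≥0∞)⁻¹ •
    ∑ i : Fin (N - 1), (betaMeasure α α).map fun u => resample i u x
  measurable' := by
    have : SFinite (betaMeasure α α) := by unfold betaMeasure; infer_instance
    refine Measure.measurable_of_measurable_coe _ fun s hs => ?_
    simp only [Measure.smul_apply, Measure.coe_finsetSum, Finset.sum_apply, smul_eq_mul]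
    refine Measurable.const_mul (Finset.measurable_sum _ fun i _ => ?_) _
    have h : ∀ x : Config N, ((betaMeasure α α).map fun u => resample i u x) s =
        betaMeasure α α (Prod.mk x ⁻¹' ((fun p : Config N × ℝ => resample i p.2 p.1) ⁻¹' s)) :=
      fun x => Measure.map_apply ((measurable_resample i).comp measurable_prodMk_left) hs
    simp_rw [h]
    exact measurable_measure_prodMk_left (measurable_resample i hs)

/-- The law `P_t^x` at time `t` of the chain started at `x`. Each of the `N - 1` coordinates is
resampled at rate one, independently: by time `t` there have been `Poisson((N - 1) t)` updates,
each of them a step of the jump chain. -/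
def law (N : ℕ) (α : ℝ) (t : ℝ≥0) (x : Config N) : Measure (Config N) :=
  (poissonMeasure (((N - 1 : ℕ) : ℝ≥0) * t)).bind fun n => (jumpKernel N α ^ n) x

/-- The equilibrium measure on the simplex, with density
`Γ(Nα) / (Γ(α)^N N^{Nα-1}) ∏_{k=1}^N (x_k - x_{k-1})^{α-1}` with respect to Lebesgue measure. -/
def equilibrium (N : ℕ) (α : ℝ) : Measure (Config N) :=
  (volume.restrict (simplex N)).withDensity fun x => ENNReal.ofReal
    (Real.Gamma (N * α) / (Real.Gamma α ^ N * (N : ℝ) ^ (N * α - 1)) *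
      ∏ k ∈ Finset.range N, (height x (k + 1) - height x k) ^ (α - 1))

/-- The total variation distance `sup_B (μ B - ν B)`, over Borel subsets `B` of the simplex. -/
def tvDist {N : ℕ} (μ ν : Measure (Config N)) : ℝ :=
  ⨆ B : {B : Set (Config N) // MeasurableSet B ∧ B ⊆ simplex N}, (μ.real B - ν.real B)

/-- The worst-case distance to equilibrium `d_N(t) = sup_{x ∈ Ω_N} ‖P_t^x - π‖_TV`. -/
def worstDist (N : ℕ) (α : ℝ) (t : ℝ≥0) : ℝ :=
  ⨆ x : simplex N, tvDist (law N α t x) (equilibrium N α)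

/-- The mixing time `inf {t ≥ 0 : d_N(t) < ε}`, with the convention `inf ∅ = +∞`. -/
def mixingTime (N : ℕ) (α ε : ℝ) : EReal :=
  sInf ((fun t : ℝ≥0 => ((t : ℝ) : EReal)) '' {t | worstDist N α t < ε})

/-! ### The law is that of the Markov chain with the above generator -/

theorem isMarkovKernel_jumpKernel {N : ℕ} (hN : 2 ≤ N) {α : ℝ} (hα : 0 < α) :
    IsMarkovKernel (jumpKernel N α) := by
  have := isProbabilityMeasureBeta hα hα
  refine ⟨fun x => ⟨?_⟩⟩
  have h (i : Fin (N - 1)) : ((betaMeasure α α).map fun u => resample i u x) Set.univ = 1 := by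
    have hr : Measurable fun u => resample i u x :=
      (measurable_resample i).comp measurable_prodMk_left
    rw [Measure.map_apply hr MeasurableSet.univ]
    simp
  change (((N - 1 : ℕ) : ℝ≥0∞)⁻¹ •
    ∑ i : Fin (N - 1), (betaMeasure α α).map fun u => resample i u x) Set.univ = 1
  simp only [Measure.smul_apply, Measure.coe_finsetSum, Finset.sum_apply, h, smul_eq_mul,
    Finset.sum_const, Finset.card_univ, Fintype.card_fin, nsmul_eq_mul, mul_one]
  exact ENNReal.inv_mul_cancel (by norm_cast; omega) (ENNReal.natCast_ne_top _)

theorem isMarkovKernel_pow {N : ℕ} (hN : 2 ≤ N) {α : ℝ} (hα : 0 < α) (n : ℕ) :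
    IsMarkovKernel (jumpKernel N α ^ n) := by
  have := isMarkovKernel_jumpKernel hN hα
  induction n with
  | zero => rw [pow_zero]; exact inferInstanceAs (IsMarkovKernel Kernel.id)
  | succ n ih =>
    rw [pow_succ]
    exact inferInstanceAs (IsMarkovKernel ((jumpKernel N α ^ n) ∘ₖ jumpKernel N α))

theorem isProbabilityMeasure_law {N : ℕ} (hN : 2 ≤ N) {α : ℝ} (hα : 0 < α) (t : ℝ≥0)
    (x : Config N) : IsProbabilityMeasure (law N α t x) := by
  have := isMarkovKernel_pow hN hα
  exact isProbabilityMeasure_bind (measurable_of_countable _).aemeasurable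
    (Filter.Eventually.of_forall fun n => inferInstance)

theorem law_zero (N : ℕ) (α : ℝ) (x : Config N) : law N α 0 x = Measure.dirac x := by
  have h : poissonMeasure 0 = Measure.dirac 0 := by
    refine Measure.ext_of_singleton fun n => ?_
    rw [poissonMeasure_singleton]
    cases n <;> simp
  rw [law, mul_zero, h, Measure.dirac_bind (measurable_of_countable _), pow_zero]
  exact Kernel.id_apply x

theorem generator_eq {N : ℕ} (hN : 2 ≤ N) {α : ℝ} (hα : 0 < α) {f : Config N → ℝ}
    (hf : Measurable f) {M : ℝ} (hM : ∀ x, |f x| ≤ M) (x : Config N) :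
    generator N α f x = ((N - 1 : ℕ) : ℝ) * (∫ y, f y ∂(jumpKernel N α x) - f x) := by
  have := isProbabilityMeasureBeta hα hα
  have hr (i : Fin (N - 1)) : Measurable fun u => resample i u x :=
    (measurable_resample i).comp measurable_prodMk_left
  have hi (i : Fin (N - 1)) : Integrable (fun u => f (resample i u x)) (betaMeasure α α) :=
    Integrable.of_bound (hf.comp (hr i)).aestronglyMeasurable M
      (Filter.Eventually.of_forall fun u => hM _)
  have h0 : ((N - 1 : ℕ) : ℝ) ≠ 0 := by norm_cast; omega
  have hK : ∫ y, f y ∂(jumpKernel N α x) =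
      ((N - 1 : ℕ) : ℝ)⁻¹ * ∑ i : Fin (N - 1), ∫ u, f (resample i u x) ∂(betaMeasure α α) := by
    change ∫ y, f y ∂(((N - 1 : ℕ) : ℝ≥0∞)⁻¹ •
      ∑ i : Fin (N - 1), (betaMeasure α α).map fun u => resample i u x) = _
    rw [integral_smul_measure, integral_finsetSum_measure]
    · simp only [ENNReal.toReal_inv, ENNReal.toReal_natCast, smul_eq_mul]
      congr 1
      exact Finset.sum_congr rfl fun i _ =>
        integral_map (hr i).aemeasurable hf.aestronglyMeasurable
    · intro i _
      exact (integrable_map_measure hf.aestronglyMeasurable (hr i).aemeasurable).2 (hi i)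
  rw [hK, generator, mul_sub, mul_inv_cancel_left₀ h0]
  simp only [integral_sub (hi _) (integrable_const _), Finset.sum_sub_distrib]
  simp

theorem hasDerivAt_expSeries {a : ℕ → ℝ} {M : ℝ} (ha : ∀ n, |a n| ≤ M) (r : ℝ) :
    HasDerivAt (fun r : ℝ => ∑' n, r ^ n / n.factorial * a n)
      (∑' n, r ^ n / n.factorial * a (n + 1)) r := by
  set R := |r| + 1 with hR
  have hM : 0 ≤ M := (abs_nonneg _).trans (ha 0)
  have hR0 : 0 ≤ R := by positivity
  have hs : Summable fun n : ℕ => ((n : ℝ) * R ^ (n - 1) / n.factorial) * M := by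
    refine Summable.mul_right _ ?_
    rw [← summable_nat_add_iff 1]
    refine (Real.summable_pow_div_factorial R).congr fun n => ?_
    have : ((n + 1 : ℕ) : ℝ) ≠ 0 := by positivity
    rw [Nat.factorial_succ, Nat.cast_mul, Nat.add_sub_cancel, mul_div_mul_left _ _ this]
  have key := hasDerivAt_tsum_of_isPreconnected (t := Metric.ball (0 : ℝ) R)
    (g := fun n y => y ^ n / n.factorial * a n)
    (g' := fun n y => ((n : ℝ) * y ^ (n - 1) / n.factorial) * a n) (y₀ := 0) (y := r) hs
    Metric.isOpen_ball (convex_ball _ _).isPreconnected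
    (fun n y _ => ((hasDerivAt_pow n y).div_const _).mul_const _) ?_ ?_ ?_ ?_
  · have he : (∑' n : ℕ, ((n : ℝ) * r ^ (n - 1) / n.factorial) * a n) =
        ∑' n, r ^ n / n.factorial * a (n + 1) := by
      rw [tsum_eq_zero_add' ]
      · simp only [Nat.cast_zero, zero_mul, zero_div, zero_add]
        refine tsum_congr fun n => ?_
        have : ((n + 1 : ℕ) : ℝ) ≠ 0 := by positivity
        rw [Nat.factorial_succ, Nat.cast_mul, Nat.add_sub_cancel, mul_div_mul_left _ _ this]
      · refine Summable.of_norm_bounded ((Real.summable_pow_div_factorial |r|).mul_right M)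
          fun n => ?_
        have : ((n + 1 : ℕ) : ℝ) ≠ 0 := by positivity
        rw [Nat.factorial_succ, Nat.cast_mul, Nat.add_sub_cancel, mul_div_mul_left _ _ this,
          norm_mul, norm_div, norm_pow, Real.norm_eq_abs, Real.norm_natCast]
        exact mul_le_mul_of_nonneg_left (ha _) (by positivity)
    rw [← he]
    exact key
  · intro n y hy
    have hy' : |y| ≤ R := by simpa using (mem_ball_zero_iff.1 hy).le
    rw [norm_mul, norm_div, norm_mul, norm_pow, Real.norm_natCast, Real.norm_natCast,
      Real.norm_eq_abs]
    have := ha n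
    rw [Real.norm_eq_abs]
    gcongr
  · exact Metric.mem_ball_self (by positivity)
  · refine summable_of_ne_finset_zero (s := {0}) fun n hn => ?_
    simp only [Finset.mem_singleton] at hn
    simp [hn]
  · simp [hR]

/-- Integral of a bounded function against the law, as a Poisson series. -/
theorem integral_law {N : ℕ} (hN : 2 ≤ N) {α : ℝ} (hα : 0 < α) {f : Config N → ℝ}
    (hf : Measurable f) {M : ℝ} (hM : ∀ x, |f x| ≤ M) (t : ℝ≥0) (x : Config N) :
    ∫ y, f y ∂(law N α t x) = Real.exp (-(((N - 1 : ℕ) : ℝ) * t)) *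
      ∑' n : ℕ, (((N - 1 : ℕ) : ℝ) * t) ^ n / n.factorial *
        ∫ y, f y ∂((jumpKernel N α ^ n) x) := by
  have := isMarkovKernel_pow hN hα
  have := isProbabilityMeasure_law hN hα t x
  set κ : Kernel ℕ (Config N) := ⟨fun n => (jumpKernel N α ^ n) x, measurable_of_countable _⟩
    with hκ
  have hb : ∀ (μ : Measure (Config N)) [IsProbabilityMeasure μ], Integrable f μ := fun μ _ =>
    Integrable.of_bound hf.aestronglyMeasurable M (Filter.Eventually.of_forall hM)
  have hlaw : law N α t x = (κ ∘ₖ Kernel.const Unit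
      (poissonMeasure (((N - 1 : ℕ) : ℝ≥0) * t))) () := by
    rw [Kernel.comp_apply, Kernel.const_apply]; rfl
  have h1 : ∫ y, f y ∂(law N α t x) =
      ∫ n, (∫ y, f y ∂((jumpKernel N α ^ n) x))
        ∂(poissonMeasure (((N - 1 : ℕ) : ℝ≥0) * t)) := by
    have hI : Integrable f (law N α t x) := hb _
    rw [hlaw] at hI ⊢
    rw [Kernel.integral_comp hI, Kernel.const_apply]
    rfl
  rw [h1, integral_poissonMeasure, ← tsum_mul_left]
  refine tsum_congr fun n => ?_
  rw [smul_eq_mul, NNReal.coe_mul, NNReal.coe_natCast]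
  ring

/-- **Kolmogorov's forward equation** for the law, on bounded measurable functions. -/
theorem hasDerivWithinAt_integral_law {N : ℕ} (hN : 2 ≤ N) {α : ℝ} (hα : 0 < α)
    {f : Config N → ℝ} (hf : Measurable f) {M : ℝ} (hM : ∀ x, |f x| ≤ M) (x : Config N)
    (t : ℝ≥0) :
    HasDerivWithinAt (fun s : ℝ => ∫ y, f y ∂(law N α s.toNNReal x))
      (∫ y, generator N α f y ∂(law N α t x)) (Set.Ici 0) (t : ℝ) := by
  have := isMarkovKernel_pow hN hα
  have := isMarkovKernel_jumpKernel hN hα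
  have hint : ∀ (g : Config N → ℝ) (B : ℝ) (_ : Measurable g) (_ : ∀ x, |g x| ≤ B)
      (μ : Measure (Config N)) [IsProbabilityMeasure μ], Integrable g μ ∧ |∫ y, g y ∂μ| ≤ B := by
    intro g B hg hB μ _
    refine ⟨Integrable.of_bound hg.aestronglyMeasurable B (Filter.Eventually.of_forall hB), ?_⟩
    simpa using norm_integral_le_of_norm_le_const (μ := μ) (f := g) (C := B)
      (Filter.Eventually.of_forall hB)
  set l : ℝ := ((N - 1 : ℕ) : ℝ) with hl
  set a : ℕ → ℝ := fun n => ∫ y, f y ∂((jumpKernel N α ^ n) x) with ha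
  have haM : ∀ n, |a n| ≤ M := fun n => (hint f M hf hM _).2
  set Kf : Config N → ℝ := fun y => ∫ z, f z ∂(jumpKernel N α y) with hKf
  have hKfm : Measurable Kf := (hf.stronglyMeasurable.integral_kernel).measurable
  have hKfM : ∀ y, |Kf y| ≤ M := fun y => (hint f M hf hM _).2
  have haK : ∀ n, ∫ y, Kf y ∂((jumpKernel N α ^ n) x) = a (n + 1) := by
    intro n
    have hI : Integrable f ((jumpKernel N α ∘ₖ (jumpKernel N α ^ n)) x) := (hint f M hf hM _).1
    rw [ha]
    simp only [pow_succ']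
    exact (Kernel.integral_comp hI).symm
  have hgen : ∀ y, generator N α f y = l * (Kf y - f y) := generator_eq hN hα hf hM
  have hgm : Measurable (fun y => l * (Kf y - f y)) := (hKfm.sub hf).const_mul _
  have hgM : ∀ y, |l * (Kf y - f y)| ≤ l * (M + M) := by
    intro y
    rw [abs_mul, abs_of_nonneg (by positivity : (0 : ℝ) ≤ l)]
    gcongr
    exact (abs_sub _ _).trans (add_le_add (hKfM y) (hM y))
  have hsum : ∀ (r : ℝ) (b : ℕ → ℝ), (∀ n, |b n| ≤ M) →
      Summable fun n : ℕ => r ^ n / n.factorial * b n := by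
    intro r b hb
    refine Summable.of_norm_bounded ((Real.summable_pow_div_factorial |r|).mul_right M)
      fun n => ?_
    rw [norm_mul, norm_div, norm_pow, Real.norm_eq_abs, Real.norm_natCast]
    exact mul_le_mul_of_nonneg_left (hb _) (by positivity)
  have hD : HasDerivAt (fun s : ℝ => Real.exp (-(l * s)) *
      ∑' n : ℕ, (l * s) ^ n / n.factorial * a n)
      (∫ y, generator N α f y ∂(law N α t x)) (t : ℝ) := by
    have h1 : HasDerivAt (fun s : ℝ => l * s) l (t : ℝ) := by
      simpa using (hasDerivAt_id (t : ℝ)).const_mul l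
    have h2 := (hasDerivAt_expSeries haM (l * t)).comp (t : ℝ) h1
    have h3 := h1.neg.exp.mul h2
    refine h3.congr_deriv ?_
    simp only [hgen]
    rw [integral_law hN hα hgm hgM]
    have h4 : ∀ n : ℕ, ∫ y, l * (Kf y - f y) ∂((jumpKernel N α ^ n) x) =
        l * (a (n + 1) - a n) := by
      intro n
      rw [integral_const_mul, integral_sub (hint Kf M hKfm hKfM _).1 (hint f M hf hM _).1, haK]
    simp only [h4]
    have h5 : ∑' n : ℕ, (l * t) ^ n / n.factorial * (l * (a (n + 1) - a n)) =
        l * (∑' n : ℕ, (l * t) ^ n / n.factorial * a (n + 1) -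
          ∑' n : ℕ, (l * t) ^ n / n.factorial * a n) := by
      rw [← (hsum _ _ fun n => haM (n + 1)).tsum_sub (hsum _ _ haM), ← tsum_mul_left]
      exact tsum_congr fun n => by ring
    rw [h5]
    simp only [Function.comp, Pi.neg_apply]
    ring
  refine hD.hasDerivWithinAt.congr (fun s hs => ?_) ?_
  · rw [integral_law hN hα hf hM, Real.coe_toNNReal _ hs]
  · rw [integral_law hN hα hf hM, Real.toNNReal_coe]

end AdjacentWalk

end

/-!
The lower bound is an instance of Wilson's method. The sine mode `f x = ∑ sin(πk/N) (x_k - k)` is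
an eigenfunction of the generator with eigenvalue `-λ`, `λ = 1 - cos(π/N) ≤ π² / (2N²)`
(`sum_sin_mul_gap_sub`). Started from a configuration with `f` of order `N²`, its mean at time
`t` is of order `N² exp(-λt)`, which for `t = N²/π² (log N - C)` is at least of order
`exp(C/2) N^{3/2}`. Its standard deviation is at most of order `N^{3/2}` at all times
(`law_real_sineMode_far_le`), so for large `C` the value of `f` identifies the starting point.

The variance bound needs the second moments of the increments to stay bounded. After the squares
are multiplied by `E[u(1-u)] / E[u²]`, a resampling replaces the mean of each product of two
increments by a convex combination of such means, so their maximum cannot grow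
(`integral_gapProd_pow_le`); a starting point with increments in `[0, 2]` therefore keeps bounded
second moments. The moment recursions are carried out for the jump chain and then summed against
the Poisson number of jumps.

No information on `f` under equilibrium is used. Take `K` starting points for which the means of
`f` at time `t` are far apart, and disjoint windows around these means. The chain started at the
`j`-th point is in the `j`-th window with high probability, whereas the equilibrium measure, of
total mass at most one by the Dirichlet integral (`equilibrium_univ_le_one`), gives mass at most
`1/K` to some window (`one_sub_le_worstDist`).
-/

noncomputable section

namespace AdjacentWalk

/-! ### Moments of the symmetric Beta distribution -/

theorem ae_mem_Ioo_betaMeasure (α β : ℝ) : ∀ᵐ u ∂betaMeasure α β, u ∈ Set.Ioo (0 : ℝ) 1 := by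
  have hm : Measurable (betaPDF α β) := (measurable_betaPDFReal α β).ennreal_ofReal
  rw [betaMeasure, ae_withDensity_iff hm]
  refine Filter.Eventually.of_forall fun u hu => ?_
  by_contra h
  exact hu (by rw [betaPDF_eq, if_neg (show ¬(0 < u ∧ u < 1) from h), ENNReal.ofReal_zero])

theorem integrable_betaMeasure {α : ℝ} (hα : 0 < α) {g : ℝ → ℝ} (hg : Continuous g) :
    Integrable g (betaMeasure α α) := by
  have := isProbabilityMeasureBeta hα hα
  obtain ⟨M, hM⟩ := (isCompact_Icc (a := (0 : ℝ)) (b := 1)).exists_bound_of_continuousOn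
    hg.continuousOn
  refine Integrable.of_bound hg.aestronglyMeasurable M ?_
  filter_upwards [ae_mem_Ioo_betaMeasure α α] with u hu
  exact hM u (Set.Ioo_subset_Icc_self hu)

/-- The symmetric Beta distribution is invariant under `u ↦ 1 - u`. -/
theorem integral_one_sub_betaMeasure (α : ℝ) (g : ℝ → ℝ) :
    ∫ u, g (1 - u) ∂(betaMeasure α α) = ∫ u, g u ∂(betaMeasure α α) := by
  have hm : Measurable (betaPDF α α) := (measurable_betaPDFReal α α).ennreal_ofReal
  have hfin : ∀ᵐ u, betaPDF α α u < ∞ :=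
    Filter.Eventually.of_forall fun u => ENNReal.ofReal_lt_top
  have hsymm : ∀ u, betaPDF α α (1 - u) = betaPDF α α u := by
    intro u
    simp only [betaPDF_eq]
    by_cases h : 0 < u ∧ u < 1
    · rw [if_pos h, if_pos ⟨by linarith [h.2], by linarith [h.1]⟩, sub_sub_cancel]
      congr 1
      ring
    · rw [if_neg h, if_neg fun h' => h ⟨by linarith [h'.2], by linarith [h'.1]⟩]
  rw [betaMeasure, integral_withDensity_eq_integral_toReal_smul hm hfin,
    integral_withDensity_eq_integral_toReal_smul hm hfin,
    ← integral_sub_left_eq_self (fun u => (betaPDF α α u).toReal • g u) volume 1]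
  simp only [hsymm]

theorem integral_id_betaMeasure {α : ℝ} (hα : 0 < α) :
    ∫ u, u ∂(betaMeasure α α) = 1 / 2 := by
  have := isProbabilityMeasureBeta hα hα
  have h := integral_one_sub_betaMeasure α fun u => u
  rw [integral_sub (integrable_const _) (integrable_betaMeasure hα continuous_id')] at h
  simp only [integral_const, probReal_univ, smul_eq_mul, mul_one] at h
  linarith

theorem integral_mul_one_sub_betaMeasure_pos {α : ℝ} (hα : 0 < α) :
    0 < ∫ u, u * (1 - u) ∂(betaMeasure α α) := by
  have := isProbabilityMeasureBeta hα hα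
  have hpos : ∀ᵐ u ∂betaMeasure α α, 0 < u * (1 - u) := by
    filter_upwards [ae_mem_Ioo_betaMeasure α α] with u hu
    exact mul_pos hu.1 (by linarith [hu.2])
  rw [integral_pos_iff_support_of_nonneg_ae (hpos.mono fun u hu => hu.le)
    (integrable_betaMeasure hα (by fun_prop))]
  have h1 : betaMeasure α α (Function.support fun u : ℝ => u * (1 - u)) = 1 := by
    rw [prob_compl_eq_zero_iff₀ .. |>.symm]
    · exact (hpos.mono fun u hu => hu.ne' : ∀ᵐ u ∂betaMeasure α α, u * (1 - u) ≠ 0)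
    · exact (measurableSet_support (by fun_prop)).nullMeasurableSet
  rw [h1]
  exact one_pos

/-- The second moment of the symmetric Beta distribution. -/
def betaSq (α : ℝ) : ℝ := ∫ u, u ^ 2 ∂(betaMeasure α α)

theorem integral_mul_one_sub_betaMeasure {α : ℝ} (hα : 0 < α) :
    ∫ u, u * (1 - u) ∂(betaMeasure α α) = 1 / 2 - betaSq α := by
  have : (fun u : ℝ => u * (1 - u)) = fun u => u - u ^ 2 := by ext u; ring
  rw [this, integral_sub (integrable_betaMeasure hα (by fun_prop))
    (integrable_betaMeasure hα (by fun_prop)), integral_id_betaMeasure hα, betaSq]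

theorem betaSq_lt {α : ℝ} (hα : 0 < α) : betaSq α < 1 / 2 := by
  have := integral_mul_one_sub_betaMeasure_pos hα
  rw [integral_mul_one_sub_betaMeasure hα] at this
  linarith

theorem betaSq_ge {α : ℝ} (hα : 0 < α) : 1 / 4 ≤ betaSq α := by
  have := isProbabilityMeasureBeta hα hα
  have h : 0 ≤ ∫ u, (u ^ 2 - u + 1 / 4) ∂(betaMeasure α α) :=
    integral_nonneg fun u => by
      have := sq_nonneg (u - 1 / 2)
      simp only [Pi.zero_apply]
      linarith
  rw [integral_add (integrable_betaMeasure hα (by fun_prop)) (integrable_const _),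
    integral_sub (integrable_betaMeasure hα (by fun_prop))
    (integrable_betaMeasure hα (by fun_prop)), integral_id_betaMeasure hα] at h
  simp only [integral_const, probReal_univ, smul_eq_mul] at h
  rw [betaSq]
  linarith

theorem integral_quadratic_betaMeasure {α : ℝ} (hα : 0 < α) (a b c : ℝ) :
    ∫ u, (a + b * u + c * u ^ 2) ∂(betaMeasure α α) = a + b / 2 + c * betaSq α := by
  have := isProbabilityMeasureBeta hα hα
  rw [integral_add (integrable_betaMeasure hα (by fun_prop))
    (integrable_betaMeasure hα (by fun_prop)), integral_add (integrable_const _)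
    (integrable_betaMeasure hα (by fun_prop)), integral_const_mul, integral_const_mul,
    integral_id_betaMeasure hα, betaSq]
  simp
  ring

/-! ### Heights and increments under resampling -/

theorem height_zero {N : ℕ} (x : Config N) : height x 0 = 0 := by simp [height]

theorem height_last {N : ℕ} (hN : 1 ≤ N) (x : Config N) : height x N = N := by
  rw [height, if_neg (by omega), dif_neg (by omega)]

theorem height_succ {N : ℕ} (x : Config N) (i : Fin (N - 1)) : height x (i + 1) = x i := by
  simp [height]

@[fun_prop]
theorem continuous_height {N : ℕ} (k : ℕ) : Continuous fun x : Config N => height x k := by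
  unfold height
  split_ifs <;> fun_prop

theorem height_resample {N : ℕ} (i : Fin (N - 1)) (u : ℝ) (x : Config N) (k : ℕ) :
    height (resample i u x) k =
      if k = i + 1 then u * height x i + (1 - u) * height x (i + 2) else height x k := by
  by_cases hk0 : k = 0
  · subst hk0
    simp [height_zero]
  by_cases hk : k - 1 < N - 1
  · obtain ⟨j, rfl⟩ : ∃ j : Fin (N - 1), k = j + 1 := ⟨⟨k - 1, hk⟩, by simp; omega⟩
    rw [height_succ, height_succ, resample, Function.update_apply]
    simp only [Nat.add_right_cancel_iff, Fin.val_inj]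
  · rw [if_neg (by omega), height, height, if_neg hk0, dif_neg hk, if_neg hk0, dif_neg hk]

@[fun_prop]
theorem continuous_resample_left {N : ℕ} (i : Fin (N - 1)) (x : Config N) :
    Continuous fun u => resample i u x := by
  unfold resample
  fun_prop

/-- The increment `x_{k+1} - x_k`. -/
def gap {N : ℕ} (x : Config N) (k : ℕ) : ℝ := height x (k + 1) - height x k

@[fun_prop]
theorem continuous_gap {N : ℕ} (k : ℕ) : Continuous fun x : Config N => gap x k := by
  unfold gap
  fun_prop

theorem mem_simplex_iff {N : ℕ} {x : Config N} : x ∈ simplex N ↔ ∀ k < N, 0 ≤ gap x k :=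
  forall₂_congr fun _ _ => sub_nonneg.symm

theorem gap_resample_left {N : ℕ} (i : Fin (N - 1)) (u : ℝ) (x : Config N) :
    gap (resample i u x) i = (1 - u) * (gap x i + gap x (i + 1)) := by
  simp only [gap, height_resample, if_true, if_neg (show (i : ℕ) ≠ i + 1 by omega)]
  ring_nf

theorem gap_resample_right {N : ℕ} (i : Fin (N - 1)) (u : ℝ) (x : Config N) :
    gap (resample i u x) (i + 1) = u * (gap x i + gap x (i + 1)) := by
  simp only [gap, height_resample, if_true, if_neg (show (i : ℕ) + 1 + 1 ≠ i + 1 by omega)]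
  ring_nf

theorem gap_resample_of_ne {N : ℕ} (i : Fin (N - 1)) (u : ℝ) (x : Config N) {k : ℕ}
    (h1 : k ≠ i) (h2 : k ≠ i + 1) : gap (resample i u x) k = gap x k := by
  simp only [gap, height_resample, if_neg h2, if_neg (show k + 1 ≠ i + 1 by omega)]

theorem resample_mem_simplex {N : ℕ} {x : Config N} (hx : x ∈ simplex N) (i : Fin (N - 1))
    {u : ℝ} (hu : u ∈ Set.Icc (0 : ℝ) 1) : resample i u x ∈ simplex N := by
  rw [mem_simplex_iff] at hx ⊢
  have hi := i.isLt
  have hs : 0 ≤ gap x i + gap x (i + 1) := add_nonneg (hx i (by omega)) (hx (i + 1) (by omega))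
  intro k hk
  by_cases h1 : k = i
  · subst h1
    rw [gap_resample_left]
    exact mul_nonneg (by linarith [hu.2]) hs
  by_cases h2 : k = i + 1
  · subst h2
    rw [gap_resample_right]
    exact mul_nonneg hu.1 hs
  rw [gap_resample_of_ne i u x h1 h2]
  exact hx k hk

theorem isCompact_simplex (N : ℕ) : IsCompact (simplex N) := by
  have hclosed : IsClosed (simplex N) := by
    have : simplex N = ⋂ k, ⋂ (_ : k < N), {x | height x k ≤ height x (k + 1)} := by
      ext x
      simp [simplex]
    rw [this]
    exact isClosed_iInter fun k => isClosed_iInter fun _ =>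
      isClosed_le (continuous_height k) (continuous_height (k + 1))
  refine (isCompact_Icc (a := fun _ => (0 : ℝ)) (b := fun _ => (N : ℝ))).of_isClosed_subset
    hclosed fun x hx => ?_
  have hmono : ∀ j k, j ≤ k → k ≤ N → height x j ≤ height x k := by
    intro j k hjk
    induction k, hjk using Nat.le_induction with
    | base => exact fun _ => le_rfl
    | succ k _ ih => exact fun h => (ih (by omega)).trans (hx k (by omega))
  refine ⟨fun i => ?_, fun i => ?_⟩
  · have := hmono 0 (i + 1) (by omega) (by omega)
    rwa [height_zero, height_succ] at this
  · have := hmono (i + 1) N (by omega) le_rfl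
    rwa [height_last (show 1 ≤ N by have := i.isLt; omega), height_succ] at this

theorem measurableSet_simplex (N : ℕ) : MeasurableSet (simplex N) :=
  (isCompact_simplex N).measurableSet

/-! ### The sine mode -/

/-- The first Fourier sine mode `∑_k sin(πk/N) (x_k - k)` of a configuration. -/
def sineMode {N : ℕ} (x : Config N) : ℝ :=
  ∑ k ∈ Finset.range N, Real.sin (Real.pi * k / N) * (height x k - k)

/-- The rate `1 - cos(π/N)` at which the mean of the sine mode decays. -/
def relaxRate (N : ℕ) : ℝ := 1 - Real.cos (Real.pi / N)

@[fun_prop]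
theorem continuous_sineMode {N : ℕ} : Continuous fun x : Config N => sineMode x := by
  unfold sineMode
  fun_prop

theorem sineMode_resample {N : ℕ} (i : Fin (N - 1)) (u : ℝ) (x : Config N) :
    sineMode (resample i u x) = sineMode x + Real.sin (Real.pi * (i + 1 : ℕ) / N) *
      (gap x (i + 1) - u * (gap x i + gap x (i + 1))) := by
  have hi := i.isLt
  rw [← sub_eq_iff_eq_add', sineMode, sineMode, ← Finset.sum_sub_distrib,
    Finset.sum_eq_single (i + 1 : ℕ)]
  · simp only [height_resample, if_true, gap]
    ring_nf
  · intro k _ hk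
    rw [height_resample, if_neg hk, sub_self]
  · intro h
    exact absurd (Finset.mem_range.2 (by omega)) h

/-- Summation by parts: the drift of the sine mode is `-relaxRate` times itself, `sin(πk/N)` being
a Dirichlet eigenfunction of the discrete Laplacian. -/
theorem sum_sin_mul_gap_sub {N : ℕ} (hN : 2 ≤ N) (x : Config N) :
    ∑ i : Fin (N - 1), Real.sin (Real.pi * (i + 1 : ℕ) / N) *
      ((gap x (i + 1) - gap x i) / 2) = -(relaxRate N * sineMode x) := by
  set s : ℕ → ℝ := fun k => Real.sin (Real.pi * k / N) with hs
  set y : ℕ → ℝ := fun k => height x k - k with hy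
  have hN0 : (N : ℝ) ≠ 0 := by positivity
  have hsrec : ∀ k, s (k + 2) + s k = 2 * Real.cos (Real.pi / N) * s (k + 1) := by
    intro k
    have h1 : Real.pi * (k + 2 : ℕ) / N = Real.pi * (k + 1 : ℕ) / N + Real.pi / N := by
      push_cast; ring
    have h2 : Real.pi * k / N = Real.pi * (k + 1 : ℕ) / N - Real.pi / N := by
      push_cast; ring
    simp only [hs]
    rw [h1, h2, Real.sin_add, Real.sin_sub]
    ring
  have hs0 : s 0 = 0 := by simp [hs]
  have hsN : s N = 0 := by simp [hs, mul_div_assoc, div_self hN0]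
  have hy0 : y 0 = 0 := by simp [hy, height_zero]
  have hyN : y N = 0 := by simp [hy, height_last (by omega : 1 ≤ N)]
  obtain ⟨n, rfl⟩ : ∃ n, N = n + 1 := ⟨N - 1, by omega⟩
  have hsum : sineMode x = ∑ k ∈ Finset.range n, s (k + 1) * y (k + 1) := by
    rw [sineMode, Finset.sum_range_succ']
    change _ + s 0 * y 0 = _
    rw [hs0, zero_mul, add_zero]
  rw [hsum, relaxRate, Finset.mul_sum, ← Finset.sum_neg_distrib]
  change ∑ i : Fin n, s (i + 1) * ((gap x (i + 1) - gap x i) / 2) = _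
  rw [Fin.sum_univ_eq_sum_range (fun i => s (i + 1) * ((gap x (i + 1) - gap x i) / 2)) n,
    ← sub_eq_zero, ← Finset.sum_sub_distrib]
  have htel : ∀ k, s (k + 1) * ((gap x (k + 1) - gap x k) / 2) -
      -((1 - Real.cos (Real.pi / (n + 1 : ℕ))) * (s (k + 1) * y (k + 1))) =
      (s (k + 1) * y (k + 2) - s (k + 2) * y (k + 1)) / 2 -
        (s k * y (k + 1) - s (k + 1) * y k) / 2 := by
    intro k
    have h := hsrec k
    have hg : gap x (k + 1) - gap x k = y (k + 2) - 2 * y (k + 1) + y k := by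
      simp only [gap, hy]
      push_cast
      ring
    rw [hg]
    linear_combination (y (k + 1) / 2) * h
  rw [Finset.sum_congr rfl fun k _ => htel k,
    Finset.sum_range_sub fun k => (s k * y (k + 1) - s (k + 1) * y k) / 2, hs0, hsN, hy0, hyN]
  ring

/-! ### Continuous functions along the jump chain -/

/-- One step of the jump chain, integrated against a continuous function. -/
theorem integral_jumpKernel {N : ℕ} {α : ℝ} (hα : 0 < α) {φ : Config N → ℝ}
    (hφ : Continuous φ) (x : Config N) :
    ∫ y, φ y ∂(jumpKernel N α x) =
      ((N - 1 : ℕ) : ℝ)⁻¹ * ∑ i : Fin (N - 1), ∫ u, φ (resample i u x) ∂(betaMeasure α α) := by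
  have hr (i : Fin (N - 1)) : Measurable fun u => resample i u x :=
    (continuous_resample_left i x).measurable
  change ∫ y, φ y ∂(((N - 1 : ℕ) : ℝ≥0∞)⁻¹ •
    ∑ i : Fin (N - 1), (betaMeasure α α).map fun u => resample i u x) = _
  rw [integral_smul_measure, integral_finsetSum_measure]
  · simp only [ENNReal.toReal_inv, ENNReal.toReal_natCast, smul_eq_mul]
    congr 1
    exact Finset.sum_congr rfl fun i _ =>
      integral_map (hr i).aemeasurable hφ.aestronglyMeasurable
  · intro i _
    exact (integrable_map_measure hφ.aestronglyMeasurable (hr i).aemeasurable).2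
      (integrable_betaMeasure hα (hφ.comp (continuous_resample_left i x)))

theorem ae_mem_simplex_jumpKernel {N : ℕ} (α : ℝ) {x : Config N} (hx : x ∈ simplex N) :
    ∀ᵐ y ∂(jumpKernel N α x), y ∈ simplex N := by
  have hr (i : Fin (N - 1)) : Measurable fun u => resample i u x :=
    (continuous_resample_left i x).measurable
  change (((N - 1 : ℕ) : ℝ≥0∞)⁻¹ •
    ∑ i : Fin (N - 1), (betaMeasure α α).map fun u => resample i u x) (simplex N)ᶜ = 0
  have h (i : Fin (N - 1)) :
      ((betaMeasure α α).map fun u => resample i u x) (simplex N)ᶜ = 0 := by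
    rw [Measure.map_apply (hr i) (measurableSet_simplex N).compl]
    have hae : ∀ᵐ u ∂betaMeasure α α, resample i u x ∈ simplex N := by
      filter_upwards [ae_mem_Ioo_betaMeasure α α] with u hu
      exact resample_mem_simplex hx i (Set.Ioo_subset_Icc_self hu)
    exact hae
  simp [h]

theorem ae_mem_simplex_pow {N : ℕ} (α : ℝ) {x : Config N} (hx : x ∈ simplex N) (n : ℕ) :
    ∀ᵐ y ∂((jumpKernel N α ^ n) x), y ∈ simplex N := by
  have hm := measurableSet_simplex N
  induction n with
  | zero =>
    rw [pow_zero]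
    change ∀ᵐ y ∂(Kernel.id x), y ∈ simplex N
    rw [Kernel.id_apply]
    exact (ae_dirac_iff hm).2 hx
  | succ n ih =>
    rw [pow_succ']
    change ((jumpKernel N α ∘ₖ (jumpKernel N α ^ n)) x) (simplex N)ᶜ = 0
    rw [Kernel.comp_apply' _ _ _ hm.compl, lintegral_eq_zero_iff' (Kernel.measurable_coe _
      hm.compl).aemeasurable]
    filter_upwards [ih] with y hy
    exact ae_mem_simplex_jumpKernel α hy

theorem integrable_of_ae_mem_simplex {N : ℕ} {μ : Measure (Config N)} [IsFiniteMeasure μ]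
    (hμ : ∀ᵐ y ∂μ, y ∈ simplex N) {φ : Config N → ℝ} (hφ : Continuous φ) : Integrable φ μ := by
  obtain ⟨M, hM⟩ := (isCompact_simplex N).exists_bound_of_continuousOn hφ.continuousOn
  exact Integrable.of_bound hφ.aestronglyMeasurable M (hμ.mono hM)

theorem integrable_pow {N : ℕ} (hN : 2 ≤ N) {α : ℝ} (hα : 0 < α) {x : Config N}
    (hx : x ∈ simplex N) (n : ℕ) {φ : Config N → ℝ} (hφ : Continuous φ) :
    Integrable φ ((jumpKernel N α ^ n) x) :=
  have := isMarkovKernel_pow hN hα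
  integrable_of_ae_mem_simplex (ae_mem_simplex_pow α hx n) hφ

theorem integral_pow_zero {N : ℕ} (α : ℝ) (x : Config N) {φ : Config N → ℝ}
    (hφ : Continuous φ) : ∫ y, φ y ∂((jumpKernel N α ^ 0) x) = φ x := by
  rw [pow_zero]
  change ∫ y, φ y ∂(Kernel.id x) = φ x
  rw [Kernel.id_apply, integral_dirac' _ _ hφ.stronglyMeasurable]

theorem integral_pow_succ {N : ℕ} (hN : 2 ≤ N) {α : ℝ} (hα : 0 < α) {x : Config N}
    (hx : x ∈ simplex N) (n : ℕ) {φ : Config N → ℝ} (hφ : Continuous φ) :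
    ∫ y, φ y ∂((jumpKernel N α ^ (n + 1)) x) =
      ∫ y, ((N - 1 : ℕ) : ℝ)⁻¹ * ∑ i : Fin (N - 1),
        ∫ u, φ (resample i u y) ∂(betaMeasure α α) ∂((jumpKernel N α ^ n) x) := by
  have hI := integrable_pow hN hα hx (n + 1) hφ
  rw [pow_succ'] at hI ⊢
  change Integrable φ ((jumpKernel N α ∘ₖ (jumpKernel N α ^ n)) x) at hI
  change ∫ y, φ y ∂((jumpKernel N α ∘ₖ (jumpKernel N α ^ n)) x) = _
  rw [Kernel.integral_comp hI]
  simp only [integral_jumpKernel hα hφ]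

/-! ### Second moments of the increments -/

/-- The products of increments, the squares being weighted by
`E[u(1-u)] / E[u²]` so that one resampling step replaces each product by a weighted average
of such products. -/
def gapProd {N : ℕ} (α : ℝ) (j k : ℕ) (x : Config N) : ℝ :=
  if j = k then (1 / 2 - betaSq α) / betaSq α * gap x j ^ 2 else gap x j * gap x k

@[fun_prop]
theorem continuous_gapProd {N : ℕ} (α : ℝ) (j k : ℕ) :
    Continuous fun x : Config N => gapProd α j k x := by
  unfold gapProd
  split_ifs <;> fun_prop

theorem gapProd_comm {N : ℕ} (α : ℝ) (j k : ℕ) (x : Config N) :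
    gapProd α j k x = gapProd α k j x := by
  unfold gapProd
  by_cases h : j = k
  · rw [h]
  · rw [if_neg h, if_neg (Ne.symm h), mul_comm]

theorem sq_gap_eq {N : ℕ} {α : ℝ} (hα : 0 < α) (j : ℕ) (x : Config N) :
    gap x j ^ 2 = betaSq α / (1 / 2 - betaSq α) * gapProd α j j x := by
  have h1 := betaSq_lt hα
  have h2 := betaSq_ge hα
  have h3 : 1 / 2 - betaSq α ≠ 0 := by linarith
  have h4 : betaSq α ≠ 0 := by linarith
  rw [gapProd, if_pos rfl, ← mul_assoc, div_mul_div_cancel₀ h3, div_self h4, one_mul]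

/-- After resampling the point between two increments, every weighted product of these two
increments has the same mean, an average of the products before: the weights satisfy
`2 E[u²] + 2 E[u(1-u)] = 1`. -/
theorem integral_gapProd_resample_both {N : ℕ} {α : ℝ} (hα : 0 < α) (i : Fin (N - 1))
    (x : Config N) {j k : ℕ} (hj : j = i ∨ j = i + 1) (hk : k = i ∨ k = i + 1) :
    ∫ u, gapProd α j k (resample i u x) ∂(betaMeasure α α) =
      betaSq α * (gapProd α i i x + gapProd α (i + 1) (i + 1) x) +
        2 * (1 / 2 - betaSq α) * gapProd α i (i + 1) x := by
  have h2 : betaSq α ≠ 0 := by linarith [betaSq_ge hα]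
  have hR : betaSq α * (gapProd α i i x + gapProd α (i + 1) (i + 1) x) +
        2 * (1 / 2 - betaSq α) * gapProd α i (i + 1) x =
      (1 / 2 - betaSq α) * (gap x i + gap x (i + 1)) ^ 2 := by
    simp only [gapProd, if_true, if_neg (show (i : ℕ) ≠ i + 1 by omega)]
    field_simp
    ring
  rw [hR]
  set S := gap x i + gap x (i + 1) with hS
  set r := (1 / 2 - betaSq α) / betaSq α with hr
  rcases hj with rfl | rfl <;> rcases hk with rfl | rfl
  · have : ∀ u : ℝ, gapProd α i i (resample i u x) =
        r * S ^ 2 + (-2 * r * S ^ 2) * u + (r * S ^ 2) * u ^ 2 := by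
      intro u
      rw [gapProd, if_pos rfl, gap_resample_left]
      ring
    simp only [this, integral_quadratic_betaMeasure hα]
    rw [hr]
    field_simp
    ring
  · have : ∀ u : ℝ, gapProd α i (i + 1) (resample i u x) =
        0 + S ^ 2 * u + (-S ^ 2) * u ^ 2 := by
      intro u
      rw [gapProd, if_neg (by omega), gap_resample_left, gap_resample_right]
      ring
    simp only [this, integral_quadratic_betaMeasure hα]
    ring
  · have : ∀ u : ℝ, gapProd α (i + 1) i (resample i u x) =
        0 + S ^ 2 * u + (-S ^ 2) * u ^ 2 := by
      intro u
      rw [gapProd, if_neg (by omega), gap_resample_left, gap_resample_right]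
      ring
    simp only [this, integral_quadratic_betaMeasure hα]
    ring
  · have : ∀ u : ℝ, gapProd α (i + 1) (i + 1) (resample i u x) =
        0 + 0 * u + (r * S ^ 2) * u ^ 2 := by
      intro u
      rw [gapProd, if_pos rfl, gap_resample_right]
      ring
    simp only [this, integral_quadratic_betaMeasure hα]
    rw [hr]
    field_simp
    ring

theorem integral_gapProd_resample_one {N : ℕ} {α : ℝ} (hα : 0 < α) (i : Fin (N - 1))
    (x : Config N) {j k : ℕ} (hj : j = i ∨ j = i + 1) (hk : k ≠ i) (hk' : k ≠ i + 1) :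
    ∫ u, gapProd α j k (resample i u x) ∂(betaMeasure α α) =
      1 / 2 * (gapProd α i k x + gapProd α (i + 1) k x) := by
  rw [gapProd.eq_1 α i k, gapProd.eq_1 α (i + 1) k, if_neg (Ne.symm hk), if_neg (Ne.symm hk')]
  rcases hj with rfl | rfl
  · have : ∀ u : ℝ, gapProd α i k (resample i u x) =
        (gap x i + gap x (i + 1)) * gap x k + -((gap x i + gap x (i + 1)) * gap x k) * u +
          0 * u ^ 2 := by
      intro u
      rw [gapProd, if_neg (Ne.symm hk), gap_resample_left, gap_resample_of_ne i u x hk hk']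
      ring
    simp only [this, integral_quadratic_betaMeasure hα]
    ring
  · have : ∀ u : ℝ, gapProd α (i + 1) k (resample i u x) =
        0 + ((gap x i + gap x (i + 1)) * gap x k) * u + 0 * u ^ 2 := by
      intro u
      rw [gapProd, if_neg (Ne.symm hk'), gap_resample_right, gap_resample_of_ne i u x hk hk']
      ring
    simp only [this, integral_quadratic_betaMeasure hα]
    ring

/-- Maximum principle: a bound on the means of all the products is preserved by a resampling. -/
theorem integral_integral_gapProd_resample_le {N : ℕ} {α : ℝ} (hα : 0 < α)
    {μ : Measure (Config N)} [IsFiniteMeasure μ] (hμ : ∀ᵐ y ∂μ, y ∈ simplex N) {M : ℝ}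
    (hM : ∀ j < N, ∀ k < N, ∫ y, gapProd α j k y ∂μ ≤ M) (i : Fin (N - 1)) :
    ∀ j < N, ∀ k < N, Integrable
      (fun y => ∫ u, gapProd α j k (resample i u y) ∂(betaMeasure α α)) μ ∧
      ∫ y, ∫ u, gapProd α j k (resample i u y) ∂(betaMeasure α α) ∂μ ≤ M := by
  have hi := i.isLt
  have := isProbabilityMeasureBeta hα hα
  have h1 := betaSq_lt hα
  have h2 := betaSq_ge hα
  have hint : ∀ j k, Integrable (fun y => gapProd α j k y) μ := fun j k =>
    integrable_of_ae_mem_simplex hμ (continuous_gapProd α j k)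
  have hone : ∀ k < N, k ≠ i → k ≠ i + 1 → Integrable
      (fun y => 1 / 2 * (gapProd α i k y + gapProd α (i + 1) k y)) μ ∧
      ∫ y, 1 / 2 * (gapProd α i k y + gapProd α (i + 1) k y) ∂μ ≤ M := by
    intro k hk _ _
    refine ⟨((hint _ _).add (hint _ _)).const_mul _, ?_⟩
    rw [integral_const_mul, integral_add (hint _ _) (hint _ _)]
    linarith [hM i (by omega) k hk, hM (i + 1) (by omega) k hk]
  intro j hj k hk
  by_cases hji : j = i ∨ j = i + 1 <;> by_cases hki : k = i ∨ k = i + 1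
  · simp only [integral_gapProd_resample_both hα i _ hji hki]
    have hA := ((hint i i).add (hint (i + 1) (i + 1))).const_mul (betaSq α)
    have hB := (hint i (i + 1)).const_mul (2 * (1 / 2 - betaSq α))
    refine ⟨hA.add hB, ?_⟩
    rw [integral_add (by exact hA) hB, integral_const_mul, integral_const_mul,
      integral_add (hint _ _) (hint _ _)]
    have e1 := hM i (by omega) i (by omega)
    have e2 := hM (i + 1) (by omega) (i + 1) (by omega)
    have e3 := hM i (by omega) (i + 1) (by omega)
    have := mul_le_mul_of_nonneg_left (add_le_add e1 e2) (by linarith : 0 ≤ betaSq α)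
    have := mul_le_mul_of_nonneg_left e3 (by linarith : 0 ≤ 2 * (1 / 2 - betaSq α))
    linarith
  · push Not at hki
    simp only [integral_gapProd_resample_one hα i _ hji hki.1 hki.2]
    exact hone k hk hki.1 hki.2
  · push Not at hji
    simp only [fun y => gapProd_comm α j k y,
      integral_gapProd_resample_one hα i _ hki hji.1 hji.2]
    exact hone j hj hji.1 hji.2
  · push Not at hji hki
    have : ∀ u (y : Config N), gapProd α j k (resample i u y) = gapProd α j k y := by
      intro u y
      simp only [gapProd, gap_resample_of_ne i u y hji.1 hji.2,
        gap_resample_of_ne i u y hki.1 hki.2]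
    simp only [this, integral_const, probReal_univ, one_smul]
    exact ⟨hint j k, hM j hj k hk⟩

theorem integral_gapProd_pow_le {N : ℕ} (hN : 2 ≤ N) {α : ℝ} (hα : 0 < α) {x : Config N}
    (hx : x ∈ simplex N) {M : ℝ} (hM : ∀ j < N, ∀ k < N, gapProd α j k x ≤ M) (n : ℕ) :
    ∀ j < N, ∀ k < N, ∫ y, gapProd α j k y ∂((jumpKernel N α ^ n) x) ≤ M := by
  have := isMarkovKernel_pow hN hα
  have hN0 : (0 : ℝ) < (N - 1 : ℕ) := by exact_mod_cast (by omega : 0 < N - 1)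
  induction n with
  | zero =>
    intro j hj k hk
    rw [integral_pow_zero α x (continuous_gapProd α j k)]
    exact hM j hj k hk
  | succ n ih =>
    intro j hj k hk
    have h := fun i =>
      integral_integral_gapProd_resample_le hα (ae_mem_simplex_pow α hx n) ih i j hj k hk
    rw [integral_pow_succ hN hα hx n (continuous_gapProd α j k), integral_const_mul,
      integral_finsetSum _ fun i _ => (h i).1, inv_mul_le_iff₀ hN0]
    refine (Finset.sum_le_sum fun i _ => (h i).2).trans (le_of_eq ?_)
    simp

/-! ### Moments of the sine mode -/

theorem integral_sineMode_pow {N : ℕ} (hN : 2 ≤ N) {α : ℝ} (hα : 0 < α) {x : Config N}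
    (hx : x ∈ simplex N) (n : ℕ) :
    ∫ y, sineMode y ∂((jumpKernel N α ^ n) x) =
      (1 - relaxRate N / (N - 1 : ℕ)) ^ n * sineMode x := by
  have hN0 : ((N - 1 : ℕ) : ℝ) ≠ 0 := by exact_mod_cast (by omega : N - 1 ≠ 0)
  induction n with
  | zero => rw [integral_pow_zero α x continuous_sineMode, pow_zero, one_mul]
  | succ n ih =>
    rw [integral_pow_succ hN hα hx n continuous_sineMode, pow_succ', mul_assoc, ← ih,
      ← integral_const_mul]
    congr 1
    ext y
    have h : ∀ i : Fin (N - 1), ∫ u, sineMode (resample i u y) ∂(betaMeasure α α) =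
        sineMode y + Real.sin (Real.pi * (i + 1 : ℕ) / N) *
          ((gap y (i + 1) - gap y i) / 2) := by
      intro i
      set s := Real.sin (Real.pi * (i + 1 : ℕ) / N)
      have : ∀ u, sineMode (resample i u y) = (sineMode y + s * gap y (i + 1)) +
          (-(s * (gap y i + gap y (i + 1)))) * u + 0 * u ^ 2 := by
        intro u
        rw [sineMode_resample]
        ring
      simp only [this, integral_quadratic_betaMeasure hα]
      ring
    simp only [h, Finset.sum_add_distrib, sum_sin_mul_gap_sub hN, Finset.sum_const,
      Finset.card_univ, Fintype.card_fin, nsmul_eq_mul]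
    field_simp
    ring

/-- One resampling changes the mean of the square of the sine mode by the drift term plus at most
twice the sum of the squares of the two increments. -/
theorem integral_sineMode_sq_resample_le {N : ℕ} {α : ℝ} (hα : 0 < α) {y : Config N}
    (hy : y ∈ simplex N) (i : Fin (N - 1)) :
    ∫ u, sineMode (resample i u y) ^ 2 ∂(betaMeasure α α) ≤
      sineMode y ^ 2 + 2 * sineMode y * (Real.sin (Real.pi * (i + 1 : ℕ) / N) *
        ((gap y (i + 1) - gap y i) / 2)) + 2 * (gap y i ^ 2 + gap y (i + 1) ^ 2) := by
  have hi := i.isLt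
  have := isProbabilityMeasureBeta hα hα
  set s := Real.sin (Real.pi * (i + 1 : ℕ) / N) with hs
  set a := gap y i with ha
  set b := gap y (i + 1) with hb
  have ha0 : 0 ≤ a := mem_simplex_iff.1 hy i (by omega)
  have hb0 : 0 ≤ b := mem_simplex_iff.1 hy (i + 1) (by omega)
  have hs1 : s ^ 2 ≤ 1 := by
    have := Real.sin_sq_le_one (Real.pi * (i + 1 : ℕ) / N)
    exact this
  have hle : ∫ u, sineMode (resample i u y) ^ 2 ∂(betaMeasure α α) ≤
      ∫ u, ((sineMode y ^ 2 + 2 * sineMode y * (s * b) + 2 * (a ^ 2 + b ^ 2)) +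
        (-(2 * sineMode y * (s * (a + b)))) * u + 0 * u ^ 2) ∂(betaMeasure α α) := by
    refine integral_mono_ae (integrable_betaMeasure hα (by fun_prop))
      (integrable_betaMeasure hα (by fun_prop)) ?_
    filter_upwards [ae_mem_Ioo_betaMeasure α α] with u hu
    rw [sineMode_resample]
    have hJ : (b - u * (a + b)) ^ 2 ≤ 2 * (a ^ 2 + b ^ 2) := by
      have h1 : |b - u * (a + b)| ≤ a + b := by
        have hu0 := mul_nonneg hu.1.le (add_nonneg ha0 hb0)
        have hu1 := mul_nonneg (by linarith [hu.2] : 0 ≤ 1 - u) (add_nonneg ha0 hb0)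
        rw [abs_le]
        constructor <;> linarith
      have h2 := sq_le_sq' (abs_le.1 h1).1 (abs_le.1 h1).2
      linarith [sq_nonneg (a - b)]
    have hJ' := mul_le_mul hs1 hJ (sq_nonneg _) zero_le_one
    linarith
  refine hle.trans (le_of_eq ?_)
  rw [integral_quadratic_betaMeasure hα]
  ring

/-- If all second moments of the increments stay below `V`, the second moment of the sine mode
contracts at twice the relaxation rate, up to the level `2 (N - 1) V / λ`. -/
theorem integral_sineMode_sq_pow_le {N : ℕ} (hN : 2 ≤ N) {α : ℝ} (hα : 0 < α) {x : Config N}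
    (hx : x ∈ simplex N) {V : ℝ}
    (hV : ∀ n, ∀ k < N, ∫ y, gap y k ^ 2 ∂((jumpKernel N α ^ n) x) ≤ V)
    (hl : 0 < relaxRate N) (hq : 0 ≤ 1 - 2 * relaxRate N / (N - 1 : ℕ)) (n : ℕ) :
    ∫ y, sineMode y ^ 2 ∂((jumpKernel N α ^ n) x) ≤
      (1 - 2 * relaxRate N / (N - 1 : ℕ)) ^ n * sineMode x ^ 2 +
        2 * (N - 1 : ℕ) * V / relaxRate N := by
  have hN0 : (0 : ℝ) < (N - 1 : ℕ) := by exact_mod_cast (by omega : 0 < N - 1)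
  have hV0 : 0 ≤ V := (integral_nonneg fun y => sq_nonneg _).trans (hV 0 0 (by omega))
  have hint : ∀ (m : ℕ) {φ : Config N → ℝ}, Continuous φ →
      Integrable φ ((jumpKernel N α ^ m) x) := fun m _ hφ => integrable_pow hN hα hx m hφ
  set q := 1 - 2 * relaxRate N / (N - 1 : ℕ) with hqdef
  set D := 2 * (N - 1 : ℕ) * V / relaxRate N with hD
  have hqD : (1 - q) * D = 4 * V := by
    rw [hqdef, hD]
    field_simp
    ring
  induction n with
  | zero =>
    rw [integral_pow_zero α x (by fun_prop), pow_zero, one_mul]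
    have : 0 ≤ D := by positivity
    linarith
  | succ n ih =>
    have hstep : ∫ y, sineMode y ^ 2 ∂((jumpKernel N α ^ (n + 1)) x) ≤
        ∫ y, (q * sineMode y ^ 2 + ((N - 1 : ℕ) : ℝ)⁻¹ *
          ∑ i : Fin (N - 1), 2 * (gap y i ^ 2 + gap y (i + 1) ^ 2))
            ∂((jumpKernel N α ^ n) x) := by
      rw [integral_pow_succ hN hα hx n (by fun_prop)]
      refine integral_mono_of_nonneg (Filter.Eventually.of_forall fun y => ?_)
        (hint n (by fun_prop)) ?_
      · exact mul_nonneg (by positivity) (Finset.sum_nonneg fun i _ =>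
          integral_nonneg fun u => sq_nonneg _)
      filter_upwards [ae_mem_simplex_pow α hx n] with y hy
      have h1 := Finset.sum_le_sum fun (i : Fin (N - 1)) (_ : i ∈ Finset.univ) =>
        integral_sineMode_sq_resample_le hα hy i
      rw [Finset.sum_add_distrib, Finset.sum_add_distrib, ← Finset.mul_sum,
        sum_sin_mul_gap_sub hN] at h1
      simp only [Finset.sum_const, Finset.card_univ, Fintype.card_fin, nsmul_eq_mul] at h1
      have h2 := mul_le_mul_of_nonneg_left h1 (inv_nonneg.2 hN0.le)
      refine h2.trans (le_of_eq ?_)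
      rw [hqdef]
      field_simp
      ring
    refine hstep.trans ?_
    rw [integral_add (hint n (by fun_prop)) (hint n (by fun_prop)), integral_const_mul,
      integral_const_mul, integral_finsetSum _ fun i _ => hint n (by fun_prop)]
    have hsum : ∑ i : Fin (N - 1), ∫ y, 2 * (gap y i ^ 2 + gap y (i + 1) ^ 2)
        ∂((jumpKernel N α ^ n) x) ≤ (N - 1 : ℕ) * (4 * V) := by
      refine (Finset.sum_le_sum (g := fun _ => 4 * V) fun i _ => ?_).trans (le_of_eq (by simp))
      have hi := i.isLt
      rw [integral_const_mul, integral_add (hint n (by fun_prop)) (hint n (by fun_prop))]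
      linarith [hV n i (by omega), hV n (i + 1) (by omega)]
    have h3 := mul_le_mul_of_nonneg_left hsum (inv_nonneg.2 hN0.le)
    rw [inv_mul_cancel_left₀ hN0.ne'] at h3
    have h4 := mul_le_mul_of_nonneg_left ih hq
    rw [pow_succ']
    linarith

/-! ### The sine mode at a fixed time -/

theorem ae_mem_simplex_law {N : ℕ} (α : ℝ) (t : ℝ≥0) {x : Config N} (hx : x ∈ simplex N) :
    ∀ᵐ y ∂(law N α t x), y ∈ simplex N := by
  change law N α t x (simplex N)ᶜ = 0
  rw [law, Measure.bind_apply (measurableSet_simplex N).compl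
    (measurable_of_countable _).aemeasurable]
  refine (lintegral_congr fun n => ?_).trans lintegral_zero
  exact ae_mem_simplex_pow α hx n

/-- The Poisson series of `integral_law` for continuous functions, which are bounded on the
simplex but possibly not on the ambient space. -/
theorem integral_law_of_continuous {N : ℕ} (hN : 2 ≤ N) {α : ℝ} (hα : 0 < α)
    {φ : Config N → ℝ} (hφ : Continuous φ) (t : ℝ≥0) {x : Config N} (hx : x ∈ simplex N) :
    ∫ y, φ y ∂(law N α t x) = Real.exp (-(((N - 1 : ℕ) : ℝ) * t)) *
      ∑' n : ℕ, (((N - 1 : ℕ) : ℝ) * t) ^ n / n.factorial *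
        ∫ y, φ y ∂((jumpKernel N α ^ n) x) := by
  obtain ⟨M, hM⟩ := (isCompact_simplex N).exists_bound_of_continuousOn hφ.continuousOn
  have heq : ∀ {μ : Measure (Config N)}, (∀ᵐ y ∂μ, y ∈ simplex N) →
      ∫ y, φ y ∂μ = ∫ y, (simplex N).indicator φ y ∂μ := fun h =>
    integral_congr_ae (h.mono fun y hy => (Set.indicator_of_mem hy φ).symm)
  have hb : ∀ y, |(simplex N).indicator φ y| ≤ max M 0 := by
    intro y
    by_cases hy : y ∈ simplex N
    · rw [Set.indicator_of_mem hy]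
      exact (hM y hy).trans (le_max_left _ _)
    · rw [Set.indicator_of_notMem hy, abs_zero]
      exact le_max_right _ _
  rw [heq (ae_mem_simplex_law α t hx),
    integral_law hN hα (hφ.measurable.indicator (measurableSet_simplex N)) hb]
  simp only [heq (ae_mem_simplex_pow α hx _)]

theorem hasSum_pow_div_factorial_mul (r q c : ℝ) :
    HasSum (fun n : ℕ => r ^ n / n.factorial * (q ^ n * c)) (Real.exp (r * q) * c) := by
  have h : HasSum (fun n : ℕ => (r * q) ^ n / n.factorial) (Real.exp (r * q)) := by
    rw [Real.exp_eq_exp_ℝ]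
    exact NormedSpace.expSeries_div_hasSum_exp (r * q)
  convert! h.mul_right c using 2 with n
  rw [mul_pow]
  ring

theorem integral_sineMode_law {N : ℕ} (hN : 2 ≤ N) {α : ℝ} (hα : 0 < α) (t : ℝ≥0)
    {x : Config N} (hx : x ∈ simplex N) :
    ∫ y, sineMode y ∂(law N α t x) = Real.exp (-(relaxRate N * t)) * sineMode x := by
  have hN0 : ((N - 1 : ℕ) : ℝ) ≠ 0 := by exact_mod_cast (by omega : N - 1 ≠ 0)
  rw [integral_law_of_continuous hN hα continuous_sineMode t hx]
  simp only [integral_sineMode_pow hN hα hx]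
  rw [(hasSum_pow_div_factorial_mul _ _ _).tsum_eq, ← mul_assoc, ← Real.exp_add]
  congr 2
  field_simp
  ring

theorem integral_sineMode_sq_law_le {N : ℕ} (hN : 2 ≤ N) {α : ℝ} (hα : 0 < α) (t : ℝ≥0)
    {x : Config N} (hx : x ∈ simplex N) {V : ℝ}
    (hV : ∀ n, ∀ k < N, ∫ y, gap y k ^ 2 ∂((jumpKernel N α ^ n) x) ≤ V)
    (hl : 0 < relaxRate N) (hq : 0 ≤ 1 - 2 * relaxRate N / (N - 1 : ℕ)) :
    ∫ y, sineMode y ^ 2 ∂(law N α t x) ≤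
      (Real.exp (-(relaxRate N * t)) * sineMode x) ^ 2 +
        2 * (N - 1 : ℕ) * V / relaxRate N := by
  have hN0 : ((N - 1 : ℕ) : ℝ) ≠ 0 := by exact_mod_cast (by omega : N - 1 ≠ 0)
  rw [integral_law_of_continuous hN hα (by fun_prop) t hx]
  set r : ℝ := ((N - 1 : ℕ) : ℝ) * t with hr
  set q := 1 - 2 * relaxRate N / (N - 1 : ℕ) with hqdef
  set D := 2 * (N - 1 : ℕ) * V / relaxRate N with hD
  have hr0 : 0 ≤ r := by positivity
  have hS := (hasSum_pow_div_factorial_mul r q (sineMode x ^ 2)).add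
    (hasSum_pow_div_factorial_mul r 1 D)
  have hle : ∀ n : ℕ, r ^ n / n.factorial * ∫ y, sineMode y ^ 2 ∂((jumpKernel N α ^ n) x) ≤
      r ^ n / n.factorial * (q ^ n * sineMode x ^ 2) + r ^ n / n.factorial * (1 ^ n * D) := by
    intro n
    rw [← mul_add, one_pow, one_mul]
    exact mul_le_mul_of_nonneg_left (integral_sineMode_sq_pow_le hN hα hx hV hl hq n)
      (by positivity)
  have hsum := Summable.of_nonneg_of_le (fun n => mul_nonneg (by positivity)
    (integral_nonneg fun y => sq_nonneg _)) hle hS.summable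
  have h1 := hsum.tsum_le_tsum hle hS.summable
  rw [hS.tsum_eq] at h1
  refine (mul_le_mul_of_nonneg_left h1 (Real.exp_pos _).le).trans (le_of_eq ?_)
  rw [mul_add, ← mul_assoc, ← mul_assoc, ← Real.exp_add, ← Real.exp_add, mul_pow,
    ← Real.exp_nat_mul]
  have e1 : -r + r * q = (2 : ℕ) * -(relaxRate N * t) := by
    rw [hr, hqdef]
    push_cast
    field_simp
    ring
  have e2 : -r + r * 1 = 0 := by ring
  rw [e1, e2, Real.exp_zero, one_mul]

/-- Chebyshev's inequality for the sine mode around its mean at time `t`. -/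
theorem law_real_sineMode_far_le {N : ℕ} (hN : 2 ≤ N) {α : ℝ} (hα : 0 < α) (t : ℝ≥0)
    {x : Config N} (hx : x ∈ simplex N) {V : ℝ}
    (hV : ∀ n, ∀ k < N, ∫ y, gap y k ^ 2 ∂((jumpKernel N α ^ n) x) ≤ V)
    (hl : 0 < relaxRate N) (hq : 0 ≤ 1 - 2 * relaxRate N / (N - 1 : ℕ)) {a : ℝ} (ha : 0 < a) :
    (law N α t x).real {y | a ≤ |sineMode y - Real.exp (-(relaxRate N * t)) * sineMode x|} ≤
      2 * (N - 1 : ℕ) * V / relaxRate N / a ^ 2 := by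
  have := isProbabilityMeasure_law hN hα t x
  have hint : ∀ {φ : Config N → ℝ}, Continuous φ → Integrable φ (law N α t x) := fun hφ =>
    integrable_of_ae_mem_simplex (ae_mem_simplex_law α t hx) hφ
  have hmean := integral_sineMode_law hN hα t hx
  have hsq := integral_sineMode_sq_law_le hN hα t hx hV hl hq
  set m := Real.exp (-(relaxRate N * t)) * sineMode x with hm
  have hvar : ∫ y, (sineMode y - m) ^ 2 ∂(law N α t x) ≤
      2 * (N - 1 : ℕ) * V / relaxRate N := by
    have : ∀ y : Config N, (sineMode y - m) ^ 2 =
        sineMode y ^ 2 + (-(2 * m)) * sineMode y + m ^ 2 := fun y => by ring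
    simp only [this]
    rw [integral_add (hint (by fun_prop)) (hint (by fun_prop)),
      integral_add (hint (by fun_prop)) (hint (by fun_prop)), integral_const_mul, hmean]
    simp only [integral_const, probReal_univ, one_smul]
    linarith
  have hmarkov := mul_meas_ge_le_integral_of_nonneg
    (μ := law N α t x) (f := fun y => (sineMode y - m) ^ 2)
    (Filter.Eventually.of_forall fun y => sq_nonneg _) (hint (by fun_prop)) (a ^ 2)
  have hset : {y : Config N | a ≤ |sineMode y - m|} =
      {y | a ^ 2 ≤ (sineMode y - m) ^ 2} := by
    ext y
    simp only [Set.mem_ofPred_eq]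
    rw [← sq_abs (sineMode y - m), pow_le_pow_iff_left₀ ha.le (abs_nonneg _) two_ne_zero]
  rw [hset, le_div_iff₀ (by positivity), mul_comm]
  exact hmarkov.trans hvar

/-! ### The total mass of the equilibrium measure -/

/-- The weight `t^{a-1}` on `[0, ∞)`, extended by zero to negative `t`. -/
def powWeight (a t : ℝ) : ℝ≥0∞ := if 0 ≤ t then ENNReal.ofReal (t ^ (a - 1)) else 0

@[fun_prop]
theorem measurable_powWeight (a : ℝ) : Measurable (powWeight a) :=
  Measurable.ite measurableSet_Ici (by fun_prop) measurable_const

theorem lintegral_eq_ofReal_mul_lintegral_mul_left {L : ℝ} (hL : 0 < L) {F : ℝ → ℝ≥0∞}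
    (hF : Measurable F) : ∫⁻ z, F z = ENNReal.ofReal L * ∫⁻ w, F (L * w) := by
  have h := Real.smul_map_volume_mul_left hL.ne'
  rw [abs_of_pos hL] at h
  conv_lhs => rw [← h]
  rw [lintegral_smul_measure, lintegral_map hF (by fun_prop), smul_eq_mul]

/-- The Beta integral, as a convolution of power weights. Equality fails only at `L = 0` with
`a + b = 1`: the left side vanishes there, whereas `powWeight 1 0 = 0 ^ 0 = 1`. -/
theorem lintegral_powWeight_mul_le {a b : ℝ} (ha : 0 < a) (hb : 0 < b) (L : ℝ) :
    ∫⁻ z, powWeight a z * powWeight b (L - z) ≤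
      ENNReal.ofReal (beta a b) * powWeight (a + b) L := by
  have hβ := beta_pos ha hb
  rcases lt_trichotomy L 0 with hL | rfl | hL
  · refine (lintegral_congr fun z => ?_).trans_le (lintegral_zero.trans_le zero_le)
    by_cases hz : 0 ≤ z
    · rw [powWeight, powWeight, if_neg (by linarith : ¬ 0 ≤ L - z), mul_zero]
    · rw [powWeight, if_neg hz, zero_mul]
  · refine (lintegral_congr_ae (g := fun _ => 0) ?_).trans_le (lintegral_zero.trans_le zero_le)
    filter_upwards [Measure.ae_ne volume (0 : ℝ)] with z hz
    by_cases hz0 : 0 ≤ z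
    · have : ¬ 0 ≤ 0 - z := fun h => hz (by linarith)
      rw [powWeight, powWeight, if_neg this, mul_zero]
    · rw [powWeight, if_neg hz0, zero_mul]
  · rw [lintegral_eq_ofReal_mul_lintegral_mul_left hL (by fun_prop)]
    have hae : ∀ᵐ w : ℝ, powWeight a (L * w) * powWeight b (L - L * w) =
        ENNReal.ofReal (beta a b * L ^ (a + b - 2)) * betaPDF a b w := by
      filter_upwards [Measure.ae_ne volume (0 : ℝ), Measure.ae_ne volume (1 : ℝ)] with w h0 h1
      by_cases hw : 0 < w ∧ w < 1
      · have hw1 : 0 < 1 - w := by linarith [hw.2]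
        rw [betaPDF_of_pos_lt_one hw.1 hw.2, show L - L * w = L * (1 - w) by ring, powWeight,
          powWeight, if_pos (mul_pos hL hw.1).le, if_pos (mul_pos hL hw1).le,
          ← ENNReal.ofReal_mul (Real.rpow_nonneg (mul_pos hL hw.1).le _),
          ← ENNReal.ofReal_mul (mul_nonneg hβ.le (Real.rpow_nonneg hL.le _)),
          Real.mul_rpow hL.le hw.1.le, Real.mul_rpow hL.le hw1.le,
          show a + b - 2 = (a - 1) + (b - 1) by ring, Real.rpow_add hL]
        congr 1
        field_simp
      · rw [betaPDF_eq, if_neg hw, ENNReal.ofReal_zero, mul_zero]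
        rcases lt_or_gt_of_ne h0 with h | h
        · rw [powWeight, if_neg (not_le.2 (mul_neg_of_pos_of_neg hL h)), zero_mul]
        · have hw1 : 1 < w := lt_of_le_of_ne (not_lt.1 fun h' => hw ⟨h, h'⟩) (Ne.symm h1)
          have : ¬ 0 ≤ L - L * w := by nlinarith
          rw [mul_comm, powWeight, if_neg this, zero_mul]
    have hm : Measurable (betaPDF a b) := (measurable_betaPDFReal a b).ennreal_ofReal
    rw [lintegral_congr_ae hae, lintegral_const_mul _ hm, lintegral_betaPDF_eq_one ha hb,
      mul_one, powWeight, if_pos hL.le, ← ENNReal.ofReal_mul hL.le, ← ENNReal.ofReal_mul hβ.le]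
    refine ENNReal.ofReal_le_ofReal (le_of_eq ?_)
    rw [show a + b - 1 = 1 + (a + b - 2) by ring, Real.rpow_add hL, Real.rpow_one]
    ring

/-- The heights of a path with `n` free points `x`, starting at `0` and ending at `L`. -/
def path {n : ℕ} (L : ℝ) (x : Fin n → ℝ) (k : ℕ) : ℝ :=
  if k = 0 then 0 else if h : k - 1 < n then x ⟨k - 1, h⟩ else L

theorem measurable_path {n : ℕ} (k : ℕ) :
    Measurable fun p : ℝ × (Fin n → ℝ) => path p.1 p.2 k := by
  unfold path
  split_ifs <;> fun_prop

/-- The Dirichlet weight of a path: the product of the power weights of its increments. -/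
def pathWeight {n : ℕ} (α L : ℝ) (x : Fin n → ℝ) : ℝ≥0∞ :=
  ∏ k ∈ Finset.range (n + 1), powWeight α (path L x (k + 1) - path L x k)

theorem measurable_pathWeight (n : ℕ) (α : ℝ) :
    Measurable fun p : ℝ × (Fin n → ℝ) => pathWeight α p.1 p.2 := by
  unfold pathWeight
  exact Finset.measurable_prod _ fun k _ =>
    (measurable_powWeight α).comp ((measurable_path _).sub (measurable_path _))

theorem measurable_pathWeight_right (n : ℕ) (α L : ℝ) :
    Measurable fun x : Fin n → ℝ => pathWeight α L x := by
  have h := (measurable_pathWeight n α).comp (measurable_const (a := L) |>.prodMk measurable_id)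
  exact h

theorem pathWeight_snoc {n : ℕ} (α L : ℝ) (y : Fin n → ℝ) (z : ℝ) :
    pathWeight α L (Fin.snoc y z : Fin (n + 1) → ℝ) =
      pathWeight α z y * powWeight α (L - z) := by
  have h : ∀ k ≤ n + 1, path L (Fin.snoc y z : Fin (n + 1) → ℝ) k = path z y k := by
    intro k hk
    unfold path
    by_cases h0 : k = 0
    · rw [if_pos h0, if_pos h0]
    rw [if_neg h0, if_neg h0, dif_pos (by omega : k - 1 < n + 1)]
    simp only [Fin.snoc]
    rfl
  have hz : path z y (n + 1) = z := by simp [path]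
  have hL : path L (Fin.snoc y z : Fin (n + 1) → ℝ) (n + 1 + 1) = L := by simp [path]
  rw [pathWeight, Finset.prod_range_succ, h (n + 1) le_rfl, hz, hL, pathWeight]
  congr 1
  refine Finset.prod_congr rfl fun k hk => ?_
  have := Finset.mem_range.1 hk
  rw [h (k + 1) (by omega), h k (by omega)]

/-- The Dirichlet integral, by integrating out the last point of the path. -/
theorem lintegral_pathWeight_le {α : ℝ} (hα : 0 < α) (n : ℕ) (L : ℝ) :
    ∫⁻ x : Fin n → ℝ, pathWeight α L x ≤
      ENNReal.ofReal (Real.Gamma α ^ (n + 1) / Real.Gamma ((n + 1 : ℕ) * α)) *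
        powWeight ((n + 1 : ℕ) * α) L := by
  have hΓ := Real.Gamma_pos_of_pos hα
  induction n generalizing L with
  | zero =>
    rw [Measure.volume_pi_eq_dirac 0, lintegral_dirac]
    simp [pathWeight, path, div_self hΓ.ne']
  | succ n ih =>
    have hΓ1 : 0 < Real.Gamma ((n + 1 : ℕ) * α) := Real.Gamma_pos_of_pos (by positivity)
    have he := (volume_preserving_piFinSuccAbove (fun _ : Fin (n + 1) => ℝ) (Fin.last n)).symm
    have hsymm : ∀ p : ℝ × (Fin n → ℝ),
        (MeasurableEquiv.piFinSuccAbove (fun _ : Fin (n + 1) => ℝ) (Fin.last n)).symm p =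
          (Fin.snoc p.2 p.1 : Fin (n + 1) → ℝ) := by
      intro p
      rw [MeasurableEquiv.piFinSuccAbove_symm_apply, Fin.insertNthEquiv_last]
      rfl
    have hm : Measurable fun p : ℝ × (Fin n → ℝ) =>
        pathWeight α p.1 p.2 * powWeight α (L - p.1) :=
      (measurable_pathWeight n α).mul (by fun_prop)
    rw [← he.lintegral_comp (measurable_pathWeight_right (n + 1) α L)]
    simp only [hsymm, pathWeight_snoc]
    rw [Measure.volume_eq_prod, lintegral_prod _ hm.aemeasurable]
    simp only [lintegral_mul_const _ (measurable_pathWeight_right n α _)]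
    calc ∫⁻ z, (∫⁻ y : Fin n → ℝ, pathWeight α z y) * powWeight α (L - z)
        ≤ ∫⁻ z, ENNReal.ofReal (Real.Gamma α ^ (n + 1) / Real.Gamma ((n + 1 : ℕ) * α)) *
            (powWeight ((n + 1 : ℕ) * α) z * powWeight α (L - z)) := by
          refine lintegral_mono fun z => ?_
          rw [← mul_assoc]
          exact mul_le_mul_left (ih z) _
      _ ≤ ENNReal.ofReal (Real.Gamma α ^ (n + 1) / Real.Gamma ((n + 1 : ℕ) * α)) *
            (ENNReal.ofReal (beta ((n + 1 : ℕ) * α) α) *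
              powWeight ((n + 1 : ℕ) * α + α) L) := by
          rw [lintegral_const_mul _ (by fun_prop)]
          exact mul_le_mul_right (lintegral_powWeight_mul_le (by positivity) hα L) _
      _ = _ := by
          have h1 : ((n + 1 : ℕ) : ℝ) * α + α = (n + 1 + 1 : ℕ) * α := by push_cast; ring
          rw [← mul_assoc, ← ENNReal.ofReal_mul (by positivity), beta, h1]
          congr 2
          field_simp
          exact (pow_succ _ _).symm

theorem equilibrium_univ_le_one {N : ℕ} (hN : 2 ≤ N) {α : ℝ} (hα : 0 < α) :
    equilibrium N α Set.univ ≤ 1 := by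
  obtain ⟨n, rfl⟩ : ∃ n, N = n + 1 := ⟨N - 1, by omega⟩
  have hΓ := Real.Gamma_pos_of_pos hα
  have hΓ1 : 0 < Real.Gamma ((n + 1 : ℕ) * α) := Real.Gamma_pos_of_pos (by positivity)
  have hn0 : (0 : ℝ) < (n + 1 : ℕ) := by positivity
  have hpow : (0 : ℝ) < ((n + 1 : ℕ) : ℝ) ^ ((n + 1 : ℕ) * α - 1) := Real.rpow_pos_of_pos hn0 _
  set c := Real.Gamma ((n + 1 : ℕ) * α) /
    (Real.Gamma α ^ (n + 1) * ((n + 1 : ℕ) : ℝ) ^ ((n + 1 : ℕ) * α - 1)) with hc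
  have hc0 : 0 ≤ c := by positivity
  rw [equilibrium, withDensity_apply _ MeasurableSet.univ, Measure.restrict_univ]
  calc ∫⁻ x in simplex (n + 1), ENNReal.ofReal (c *
        ∏ k ∈ Finset.range (n + 1), (height x (k + 1) - height x k) ^ (α - 1))
      = ∫⁻ x in simplex (n + 1), ENNReal.ofReal c * pathWeight α (n + 1 : ℕ) x := by
        refine setLIntegral_congr_fun (measurableSet_simplex _) fun x hx => ?_
        have h0 : ∀ k ∈ Finset.range (n + 1), 0 ≤ height x (k + 1) - height x k :=
          fun k hk => mem_simplex_iff.1 hx k (Finset.mem_range.1 hk)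
        change _ = ENNReal.ofReal c * ∏ k ∈ Finset.range (n + 1),
          powWeight α (height x (k + 1) - height x k)
        rw [ENNReal.ofReal_mul hc0, ENNReal.ofReal_prod_of_nonneg fun k hk =>
          Real.rpow_nonneg (h0 k hk) _]
        congr 1
        exact Finset.prod_congr rfl fun k hk => by rw [powWeight, if_pos (h0 k hk)]
    _ ≤ ∫⁻ x, ENNReal.ofReal c * pathWeight α (n + 1 : ℕ) x := setLIntegral_le_lintegral _ _
    _ = ENNReal.ofReal c * ∫⁻ x : Fin n → ℝ, pathWeight α (n + 1 : ℕ) x :=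
        lintegral_const_mul _ (measurable_pathWeight_right n α _)
    _ ≤ ENNReal.ofReal c *
          (ENNReal.ofReal (Real.Gamma α ^ (n + 1) / Real.Gamma ((n + 1 : ℕ) * α)) *
            powWeight ((n + 1 : ℕ) * α) (n + 1 : ℕ)) :=
        mul_le_mul_right (lintegral_pathWeight_le hα n _) _
    _ = 1 := by
        rw [powWeight, if_pos hn0.le, ← ENNReal.ofReal_mul (by positivity),
          ← ENNReal.ofReal_mul hc0, hc]
        rw [← ENNReal.ofReal_one]
        congr 1
        field_simp

/-! ### Initial configurations -/

theorem sum_sin_sq {N : ℕ} (hN : 2 ≤ N) :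
    ∑ k ∈ Finset.range N, Real.sin (Real.pi * k / N) ^ 2 = N / 2 := by
  have hN0 : (N : ℂ) ≠ 0 := by exact_mod_cast (by omega : N ≠ 0)
  have hsum := (Complex.isPrimitiveRoot_exp N (by omega)).geom_sum_eq_zero (by omega)
  have hcos : ∑ k ∈ Finset.range N, Real.cos (2 * (Real.pi * k / N)) = 0 := by
    have h := congrArg Complex.re hsum
    rw [Complex.re_sum, Complex.zero_re] at h
    rw [← h]
    refine Finset.sum_congr rfl fun k _ => ?_
    rw [← Complex.exp_nat_mul, ← Complex.exp_ofReal_mul_I_re]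
    congr 2
    push_cast
    field_simp
  have : ∀ k : ℕ, Real.sin (Real.pi * k / N) ^ 2 =
      1 / 2 - Real.cos (2 * (Real.pi * k / N)) / 2 := fun k => Real.sin_sq_eq_half_sub _
  simp only [this, Finset.sum_sub_distrib, ← Finset.sum_div, hcos]
  simp

/-- The flat configuration tilted by `θ` times a sine arch, `x_k = k + θ (N/π) sin(πk/N)`. The
arch with amplitude `N/π` has slope at most `1`, so for `θ ∈ [0, 1]` the increments lie in
`[0, 2]`. -/
def tilted (N : ℕ) (θ : ℝ) : Config N :=
  fun i => (i + 1 : ℕ) + θ * (N / Real.pi * Real.sin (Real.pi * (i + 1 : ℕ) / N))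

theorem height_tilted {N : ℕ} (hN : 2 ≤ N) (θ : ℝ) {k : ℕ} (hk : k ≤ N) :
    height (tilted N θ) k = k + θ * (N / Real.pi * Real.sin (Real.pi * k / N)) := by
  have hN0 : (N : ℝ) ≠ 0 := by positivity
  rcases Nat.eq_zero_or_pos k with rfl | hk0
  · simp [height_zero]
  rcases hk.lt_or_eq with h | rfl
  · obtain ⟨j, rfl⟩ : ∃ j : Fin (N - 1), k = j + 1 :=
      ⟨⟨k - 1, by omega⟩, by simp; omega⟩
    rw [height_succ, tilted]
  · rw [height_last (by omega), mul_div_assoc, div_self hN0, mul_one, Real.sin_pi]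
    simp

theorem gap_tilted_mem {N : ℕ} (hN : 2 ≤ N) {θ : ℝ} (hθ : θ ∈ Set.Icc (0 : ℝ) 1) {k : ℕ}
    (hk : k < N) : gap (tilted N θ) k ∈ Set.Icc (0 : ℝ) 2 := by
  have hN0 : (0 : ℝ) < N := by positivity
  set d := Real.sin (Real.pi * (k + 1 : ℕ) / N) - Real.sin (Real.pi * k / N) with hd
  have h1 : |d| ≤ Real.pi / N := by
    refine (Real.abs_sin_sub_sin_le _ _).trans (le_of_eq ?_)
    rw [show Real.pi * (k + 1 : ℕ) / N - Real.pi * k / N = Real.pi / N by push_cast; ring]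
    exact abs_of_pos (by positivity)
  have h2 : |θ * (N / Real.pi * d)| ≤ 1 := by
    rw [abs_mul, abs_mul, abs_of_nonneg hθ.1, abs_of_pos (by positivity : 0 < N / Real.pi)]
    calc θ * (N / Real.pi * |d|) ≤ 1 * (N / Real.pi * (Real.pi / N)) := by
          gcongr
          exact hθ.2
      _ = 1 := by field_simp
  have h3 : gap (tilted N θ) k = 1 + θ * (N / Real.pi * d) := by
    rw [gap, height_tilted hN θ (by omega), height_tilted hN θ (by omega), hd]
    push_cast
    ring
  rw [h3]
  constructor <;> linarith [(abs_le.1 h2).1, (abs_le.1 h2).2]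

theorem tilted_mem_simplex {N : ℕ} (hN : 2 ≤ N) {θ : ℝ} (hθ : θ ∈ Set.Icc (0 : ℝ) 1) :
    tilted N θ ∈ simplex N :=
  mem_simplex_iff.2 fun _ hk => (gap_tilted_mem hN hθ hk).1

theorem sineMode_tilted {N : ℕ} (hN : 2 ≤ N) (θ : ℝ) :
    sineMode (tilted N θ) = θ * ((N : ℝ) ^ 2 / (2 * Real.pi)) := by
  have h : ∀ k ∈ Finset.range N, Real.sin (Real.pi * k / N) * (height (tilted N θ) k - k) =
      θ * (N / Real.pi) * Real.sin (Real.pi * k / N) ^ 2 := by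
    intro k hk
    rw [height_tilted hN θ (Finset.mem_range.1 hk).le]
    ring
  rw [sineMode, Finset.sum_congr rfl h, ← Finset.mul_sum, sum_sin_sq hN]
  field_simp

/-- Started from a tilted configuration, the increments have second moments bounded uniformly
in time and in `N`. -/
theorem integral_sq_gap_tilted_le {N : ℕ} (hN : 2 ≤ N) {α : ℝ} (hα : 0 < α) {θ : ℝ}
    (hθ : θ ∈ Set.Icc (0 : ℝ) 1) (n : ℕ) {k : ℕ} (hk : k < N) :
    ∫ y, gap y k ^ 2 ∂((jumpKernel N α ^ n) (tilted N θ)) ≤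
      betaSq α / (1 / 2 - betaSq α) * 4 := by
  have h1 := betaSq_lt hα
  have h2 := betaSq_ge hα
  have h3 : 0 ≤ betaSq α / (1 / 2 - betaSq α) :=
    div_nonneg (by linarith) (by linarith)
  simp only [sq_gap_eq hα, integral_const_mul]
  refine mul_le_mul_of_nonneg_left ?_ h3
  refine integral_gapProd_pow_le hN hα (tilted_mem_simplex hN hθ) (fun i hi j hj => ?_) n
    k hk k hk
  have hgi := gap_tilted_mem hN hθ hi
  have hgj := gap_tilted_mem hN hθ hj
  unfold gapProd
  split_ifs
  · have h4 : (1 / 2 - betaSq α) / betaSq α ≤ 1 := by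
      rw [div_le_one (by linarith)]
      linarith
    calc (1 / 2 - betaSq α) / betaSq α * gap (tilted N θ) i ^ 2 ≤ 1 * 2 ^ 2 :=
          mul_le_mul h4 (pow_le_pow_left₀ hgi.1 hgi.2 2) (sq_nonneg _) zero_le_one
      _ = 4 := by norm_num
  · calc gap (tilted N θ) i * gap (tilted N θ) j ≤ 2 * 2 :=
          mul_le_mul hgi.2 hgj.2 hgj.1 zero_le_two
      _ = 4 := by norm_num

/-! ### The relaxation rate -/

theorem relaxRate_le {N : ℕ} (hN : 2 ≤ N) : relaxRate N ≤ Real.pi ^ 2 / (2 * (N : ℝ) ^ 2) := by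
  have h := Real.one_sub_sq_div_two_le_cos (x := Real.pi / N)
  rw [relaxRate]
  have : (Real.pi / N) ^ 2 / 2 = Real.pi ^ 2 / (2 * (N : ℝ) ^ 2) := by
    field_simp
  linarith

theorem relaxRate_ge {N : ℕ} (hN : 2 ≤ N) : 2 / (N : ℝ) ^ 2 ≤ relaxRate N := by
  have hN1 : (1 : ℝ) ≤ N := by exact_mod_cast (by omega : 1 ≤ N)
  have h := Real.cos_le_one_sub_mul_cos_sq (x := Real.pi / N) (by
    rw [abs_of_nonneg (by positivity)]
    exact div_le_self Real.pi_pos.le hN1)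
  rw [relaxRate]
  have : 2 / Real.pi ^ 2 * (Real.pi / N) ^ 2 = 2 / (N : ℝ) ^ 2 := by
    field_simp
  linarith

theorem relaxRate_le_half {N : ℕ} (hN : 3 ≤ N) : relaxRate N ≤ 1 / 2 := by
  have hN3 : (3 : ℝ) ≤ N := by exact_mod_cast hN
  have h : Real.cos (Real.pi / 3) ≤ Real.cos (Real.pi / N) :=
    Real.cos_le_cos_of_nonneg_of_le_pi (by positivity)
      (by linarith [Real.pi_pos]) (div_le_div_of_nonneg_left Real.pi_pos.le (by norm_num) hN3)
  rw [Real.cos_pi_div_three] at h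
  rw [relaxRate]
  linarith

/-! ### Lower bounds on the distance to equilibrium -/

theorem sub_le_worstDist {N : ℕ} (hN : 2 ≤ N) {α : ℝ} (hα : 0 < α) (t : ℝ≥0) {x : Config N}
    (hx : x ∈ simplex N) {B : Set (Config N)} (hB : MeasurableSet B) (hBs : B ⊆ simplex N) :
    (law N α t x).real B - (equilibrium N α).real B ≤ worstDist N α t := by
  have hle : ∀ (z : Config N) (A : Set (Config N)),
      (law N α t z).real A - (equilibrium N α).real A ≤ 1 := by
    intro z A
    have := isProbabilityMeasure_law hN hα t z
    have h1 : (law N α t z).real A ≤ 1 := measureReal_le_one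
    have h2 : 0 ≤ (equilibrium N α).real A := measureReal_nonneg
    linarith
  have : Nonempty {B : Set (Config N) // MeasurableSet B ∧ B ⊆ simplex N} := ⟨⟨B, hB, hBs⟩⟩
  have h1 : (law N α t x).real B - (equilibrium N α).real B ≤
      tvDist (law N α t x) (equilibrium N α) :=
    le_ciSup (f := fun A : {B : Set (Config N) // MeasurableSet B ∧ B ⊆ simplex N} =>
      (law N α t x).real A - (equilibrium N α).real A)
      ⟨1, by rintro _ ⟨A, rfl⟩; exact hle x A⟩ ⟨B, hB, hBs⟩
  have h2 : tvDist (law N α t x) (equilibrium N α) ≤ worstDist N α t :=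
    le_ciSup (f := fun z : simplex N => tvDist (law N α t z) (equilibrium N α))
      ⟨1, by rintro _ ⟨z, rfl⟩; exact ciSup_le fun A => hle z A⟩ ⟨x, hx⟩
  exact h1.trans h2

/-- Among `K` disjoint measurable sets, some set has measure at most `1 / K`. -/
theorem exists_measureReal_le_inv {Ω : Type*} [MeasurableSpace Ω] {μ : Measure Ω}
    (hμ : μ Set.univ ≤ 1) {K : ℕ} (hK : 0 < K) {B : ℕ → Set Ω} (hB : ∀ j, MeasurableSet (B j))
    (hd : Pairwise fun i j => Disjoint (B i) (B j)) : ∃ j < K, μ.real (B j) ≤ 1 / K := by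
  have : IsFiniteMeasure μ := ⟨hμ.trans_lt ENNReal.one_lt_top⟩
  have hK0 : (0 : ℝ) < K := by exact_mod_cast hK
  by_contra! h
  have h1 : ∑ j ∈ Finset.range K, μ.real (B j) ≤ 1 := by
    rw [← measureReal_biUnion_finset (fun i _ j _ hij => hd hij) fun j _ => hB j]
    exact (measureReal_mono (Set.subset_univ _)).trans
      (ENNReal.toReal_le_of_le_ofReal zero_le_one (by simpa using hμ))
  have h2 : ∑ j ∈ Finset.range K, (1 / K : ℝ) < ∑ j ∈ Finset.range K, μ.real (B j) :=
    Finset.sum_lt_sum_of_nonempty (Finset.nonempty_range_iff.2 hK.ne') fun j hj =>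
      h j (Finset.mem_range.1 hj)
  rw [Finset.sum_const, Finset.card_range, nsmul_eq_mul, mul_one_div_cancel hK0.ne'] at h2
  linarith

/-- If the `K` tilted starting points `j / K` have means of the sine mode separated by `2 a` at
time `t`, with `a` large compared with the standard deviation, then the chain is far from
equilibrium: the windows of radius `a` are disjoint, so one of them has equilibrium mass at most
`1 / K`. -/
theorem one_sub_le_worstDist {N : ℕ} (hN : 3 ≤ N) {α : ℝ} (hα : 0 < α) (t : ℝ≥0) {K : ℕ}
    (hK : 0 < K) {a : ℝ} (ha : 0 < a)
    (haK : Real.exp (-(relaxRate N * t)) * ((N : ℝ) ^ 2 / (2 * Real.pi)) = 2 * a * K) :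
    1 - 2 * (N - 1 : ℕ) * (betaSq α / (1 / 2 - betaSq α) * 4) / relaxRate N / a ^ 2 - 1 / K ≤
      worstDist N α t := by
  have hN2 : 2 ≤ N := by omega
  have hK0 : (0 : ℝ) < K := by exact_mod_cast hK
  have hl : 0 < relaxRate N := lt_of_lt_of_le (by positivity) (relaxRate_ge hN2)
  have hq : 0 ≤ 1 - 2 * relaxRate N / (N - 1 : ℕ) := by
    have h1 : (1 : ℝ) ≤ (N - 1 : ℕ) := by exact_mod_cast (by omega : 1 ≤ N - 1)
    rw [sub_nonneg, div_le_one (by linarith)]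
    linarith [relaxRate_le_half hN]
  set B : ℕ → Set (Config N) := fun j => simplex N ∩ {y | |sineMode y - 2 * a * j| < a} with hBdef
  have hopen : ∀ j : ℕ, MeasurableSet {y : Config N | |sineMode y - 2 * a * j| < a} := fun j =>
    (isOpen_lt (by fun_prop) continuous_const).measurableSet
  have hBm : ∀ j, MeasurableSet (B j) := fun j => (measurableSet_simplex N).inter (hopen j)
  have hsep : ∀ i j : ℕ, i < j → Disjoint (B i) (B j) := by
    intro i j hij
    refine Set.disjoint_left.2 fun y hyi hyj => ?_
    have hi : |sineMode y - 2 * a * i| < a := hyi.2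
    have hj : |sineMode y - 2 * a * j| < a := hyj.2
    have h1 := (abs_lt.1 hi).2
    have h2 := (abs_lt.1 hj).1
    have h3 : ((i : ℝ) + 1) ≤ j := by exact_mod_cast hij
    have h4 := mul_le_mul_of_nonneg_left h3 (by positivity : 0 ≤ 2 * a)
    linarith
  have hd : Pairwise fun i j => Disjoint (B i) (B j) := by
    intro i j hij
    rcases hij.lt_or_gt with h | h
    · exact hsep i j h
    · exact (hsep j i h).symm
  obtain ⟨j, hj, hjB⟩ := exists_measureReal_le_inv (equilibrium_univ_le_one hN2 hα) hK hBm hd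
  have hθ : (j : ℝ) / K ∈ Set.Icc (0 : ℝ) 1 :=
    ⟨by positivity, (div_le_one hK0).2 (by exact_mod_cast hj.le)⟩
  have hx := tilted_mem_simplex hN2 hθ
  have hfar := law_real_sineMode_far_le hN2 hα t hx
    (fun n k hk => integral_sq_gap_tilted_le hN2 hα hθ n hk) hl hq ha
  have hmean : Real.exp (-(relaxRate N * t)) * sineMode (tilted N (j / K)) = 2 * a * j := by
    rw [sineMode_tilted hN2, mul_left_comm, haK]
    field_simp
  rw [hmean] at hfar
  have := isProbabilityMeasure_law hN2 hα t (tilted N (j / K))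
  have hcompl : (law N α t (tilted N (j / K))).real (B j)ᶜ ≤
      (law N α t (tilted N (j / K))).real {y | a ≤ |sineMode y - 2 * a * j|} := by
    refine ENNReal.toReal_mono (measure_ne_top _ _) (measure_mono_ae ?_)
    filter_upwards [ae_mem_simplex_law α t hx] with y hy hyB
    exact not_lt.1 fun h => hyB ⟨hy, h⟩
  rw [probReal_compl_eq_one_sub (hBm j)] at hcompl
  have hfinal := sub_le_worstDist hN2 hα t hx (hBm j) Set.inter_subset_left
  linarith

end AdjacentWalk

end

open AdjacentWalk

theorem proposition3p1 (α : ℝ) (hα : 0 < α) (ε : ℝ) (hε : ε ∈ Set.Ioo (0 : ℝ) 1) :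
    ∃ C : ℝ, 0 < C ∧ ∀ N : ℕ, 2 ≤ N →
      (((N : ℝ) ^ 2 / Real.pi ^ 2 * (Real.log N - C) : ℝ) : EReal) ≤
        AdjacentWalk.mixingTime N α (1 - ε) := by
  have hε0 : 0 < ε := hε.1
  obtain ⟨K, hKε⟩ := exists_nat_ge (2 / ε)
  have hK0 : (0 : ℝ) < K := lt_of_lt_of_le (by positivity) hKε
  have hK : 0 < K := by exact_mod_cast hK0
  have hK2 : 1 / (K : ℝ) ≤ ε / 2 := by
    rw [div_le_iff₀ hε0] at hKε
    rw [div_le_div_iff₀ hK0 two_pos]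
    linarith
  have hb1 := betaSq_lt hα
  have hb2 := betaSq_ge hα
  set V := betaSq α / (1 / 2 - betaSq α) * 4 with hV
  have hV0 : 0 < V := mul_pos (div_pos (by linarith) (by linarith)) four_pos
  -- with this `Q`, `exp (1 + Q) ≥ Q` makes the Chebyshev error at most `ε / 2`
  set Q := 32 * Real.pi ^ 2 * (K : ℝ) ^ 2 * V / ε with hQ
  have hQ0 : 0 < Q := by positivity
  refine ⟨1 + Q, by positivity, fun N hN => le_sInf ?_⟩
  rintro _ ⟨t, ht, rfl⟩
  rw [EReal.coe_le_coe_iff]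
  by_contra! hlt
  have hN0 : (0 : ℝ) < N := by positivity
  have hlog : 1 + Q < Real.log N := by
    by_contra! h
    exact absurd (hlt.trans_le (mul_nonpos_of_nonneg_of_nonpos (by positivity) (by linarith)))
      (not_lt.2 t.2)
  -- for `N = 2` the claimed lower bound is negative, as `log 2 < 1`
  have hN3 : 3 ≤ N := by
    by_contra! h
    obtain rfl : N = 2 := by omega
    have := Real.log_two_lt_d9
    push_cast at hlog
    linarith
  have hl2 := relaxRate_ge hN
  have hl : 0 < relaxRate N := lt_of_lt_of_le (by positivity) hl2
  -- since `λ ≤ π² / (2 N²)`, the factor `exp (-λ t)` is still above `exp ((1 + Q) / 2) / √N`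
  have hrate : 2 * (relaxRate N * t) ≤ Real.log N - (1 + Q) := by
    have h1 := mul_le_mul (relaxRate_le hN) hlt.le t.2 (by positivity)
    refine (mul_le_mul_of_nonneg_left h1 zero_le_two).trans (le_of_eq ?_)
    field_simp
  set e := Real.exp (-(relaxRate N * t)) with he
  have he0 : 0 < e := Real.exp_pos _
  have hexp : Q ≤ N * e ^ 2 := by
    have h1 : Real.exp (1 + Q) ≤ N * e ^ 2 := by
      rw [he, ← Real.exp_nat_mul]
      conv_rhs => rw [← Real.exp_log hN0]
      rw [← Real.exp_add, Real.exp_le_exp]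
      push_cast
      linarith
    linarith [Real.add_one_le_exp (1 + Q)]
  set a := e * ((N : ℝ) ^ 2 / (2 * Real.pi)) / (2 * K) with ha
  have ha0 : 0 < a := by positivity
  have hmain := one_sub_le_worstDist hN3 hα t hK ha0 (by rw [← he, ha]; field_simp)
  have hvar : 2 * (N - 1 : ℕ) * V / relaxRate N / a ^ 2 ≤ ε / 2 := by
    have h1 : 2 * (N - 1 : ℕ) * V / relaxRate N ≤ (N : ℝ) ^ 3 * V := by
      rw [div_le_iff₀ hl]
      have h2 : ((N - 1 : ℕ) : ℝ) ≤ N := by exact_mod_cast Nat.sub_le N 1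
      calc 2 * ((N - 1 : ℕ) : ℝ) * V ≤ 2 * N * V := by gcongr
        _ = (N : ℝ) ^ 3 * V * (2 / (N : ℝ) ^ 2) := by field_simp
        _ ≤ _ := by gcongr
    rw [div_le_iff₀ (by positivity)]
    have h3 : ε / 2 * a ^ 2 = (N * e ^ 2) * ((N : ℝ) ^ 3 * ε / (32 * Real.pi ^ 2 * K ^ 2)) := by
      rw [ha]
      field_simp
      ring
    have h4 : (N : ℝ) ^ 3 * V = Q * ((N : ℝ) ^ 3 * ε / (32 * Real.pi ^ 2 * K ^ 2)) := by
      rw [hQ]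
      field_simp
    rw [h3]
    rw [h4] at h1
    exact h1.trans (mul_le_mul_of_nonneg_right hexp (by positivity))
  have htlt : worstDist N α t < 1 - ε := ht
  linarith
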